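/- Let $0<\alpha\le 2$ and let $X_1,X_2,\dots$ be i.i.d. random variables with distribution function $F(x)=1-x^{-\alpha}$ for $x\ge 1$. Let $(b_n)$ be a positive nondecreasing sequence with $b_n\to\infty$, let $0\le\beta<1/2$, and put $$\hat\mu_n=\frac1n\sum_{k=1}^n X_kI(X_k\le b_n),\qquad \hat\nu_n^2=\frac1n\sum_{k=1}^n X_k^2I(X_k\le b_n),$$ $$G_1(x)=1-\frac{\ln\big[\frac{1-x}{x}\hat\mu_n+1\big]}{\ln b_n}\ (0<x<1),\qquad G_2(y)=2-\frac{\ln\big[\frac{2-y}{y}\hat\nu_n^2+1\big]}{\ln b_n}\ (1<y<2).$$ Let $\hat\alpha=\hat\alpha(n)$ be the largest solution of $x=G_1(x)$ in $(0,1)$, and $\hat\alpha'=\hat\alpha'(n)$ the solution of $y=G_2(y)$ in $(1,2)$ (unique if $\ln b_n>2$; the largest one otherwise); each is set to $0$ if there is no solution. Below, $\Rightarrow$ is convergence in distribution as $n\to\infty$. (i) If $0<\alpha<1$ and $b_n^{\alpha}\ln b_n\le \alpha n^{1-2\beta}/\ln n$ for all large $n$, then for all large $n$ $$P\Big(|\hat\alpha-\alpha|\ge\frac{2}{n^{\beta}\ln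 b_n\sqrt{\ln b_n}}\Big)\le\frac2{n^2},\quad\text{and}\quad \frac{\sqrt n(\hat\alpha-\alpha)\ln b_n}{b_n^{\alpha/2}}\Rightarrow N\Big(0,\frac{(1-\alpha)^2}{\alpha(2-\alpha)}\Big).$$ (ii) If $1<\alpha<2$ and $b_n^{\alpha}\ln b_n\le \alpha n^{1-2\beta}/\ln n$ for all large $n$, then for all large $n$ $$P\Big(|\hat\alpha'-\alpha|\ge\frac{2}{n^{\beta}\ln b_n\sqrt{\ln b_n}}\Big)\le\frac2{n^2},\quad\text{and}\quad \frac{\sqrt n(\hat\alpha'-\alpha)\ln b_n}{b_n^{\alpha/2}}\Rightarrow N\Big(0,\frac{(2-\alpha)^2}{\alpha(4-\alpha)}\Big).$$ (iii) If $\alpha=1$ and $b_n\le n^{1-2\beta}/\ln n$ for all large $n$, then for all large $n$ $$P\Big(\Big|\frac{\hat\mu_n}{\ln b_n}-1\Big|\ge\frac{2\sqrt2}{n^{\beta}\ln b_n}\Big)\le\frac2{n^2},\quad\text{and}\quad \frac{\sqrt n\,(\hat\mu_n/\ln b_n-1)\ln b_n}{\sqrt{b_n}}\Rightarrow N(0,1).$$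 (iv) Let $\alpha=2$. If $b_n^2\le n^{1-2\beta}/\ln n$ for all large $n$, then for all large $n$ $$P\Big(\Big|\frac{\hat\nu_n^2}{\ln b_n}-2\Big|\ge\frac{2\sqrt2}{n^{\beta}\ln b_n}\Big)\le\frac2{n^2};$$ and if $b_n^2\le n^{1-\beta}/\ln n$ for all large $n$, then $$\frac{\sqrt n\,(\hat\nu_n^2/\ln b_n-2)\ln b_n}{b_n}\Rightarrow N(0,1).$$ -/

import Mathlib

open MeasureTheory ProbabilityTheory Filter Topology

noncomputable section

namespace TailIndex

/-- Truncation `x I(x ≤ c)` of a real number at level `c`. -/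
def trunc (c x : ℝ) : ℝ := if x ≤ c then x else 0

/-- Truncated sample mean of the first `n` observations (`X 0, …, X (n-1)`), at truncation
level `b n`. -/
def truncMean {Ω : Type*} (X : ℕ → Ω → ℝ) (b : ℕ → ℝ) (n : ℕ) (ω : Ω) : ℝ :=
  (n : ℝ)⁻¹ * ∑ k ∈ Finset.range n, trunc (b n) (X k ω)

/-- Truncated sample second moment of the first `n` observations, at truncation level `b n`. -/
def truncSecond {Ω : Type*} (X : ℕ → Ω → ℝ) (b : ℕ → ℝ) (n : ℕ) (ω : Ω) : ℝ :=
  (n : ℝ)⁻¹ * ∑ k ∈ Finset.range n, trunc (b n) (X k ω) ^ 2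

/-- `G₁(x) = 1 - ln((1 - x) / x * m + 1) / ln c` with `m` the truncated sample mean and `c` the
truncation level. -/
def G₁ (c m x : ℝ) : ℝ := 1 - Real.log ((1 - x) / x * m + 1) / Real.log c

/-- `G₂(y) = 2 - ln((2 - y) / y * v + 1) / ln c` with `v` the truncated sample second moment and
`c` the truncation level. -/
def G₂ (c v y : ℝ) : ℝ := 2 - Real.log ((2 - y) / y * v + 1) / Real.log c

/-- The estimator for `0 < α < 1`: the largest solution in `(0, 1)` of `x = G₁ x`. (For large `c`
there is typically a second solution in `(0, 1)`, of order `m / c`, which is close to `0`; the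
largest one is the one at which `x - G₁ x` increases.) It is `0`, a value outside `(0, 1)`, if
there is no solution. -/
def alphaHat {Ω : Type*} (X : ℕ → Ω → ℝ) (b : ℕ → ℝ) (n : ℕ) (ω : Ω) : ℝ :=
  sSup {x : ℝ | 0 < x ∧ x < 1 ∧ x = G₁ (b n) (truncMean X b n ω) x}

/-- The estimator for `1 < α < 2`: the solution in `(1, 2)` of `y = G₂ y`, which is unique as soon
as `ln c > 2`. It is `0`, a value outside `(1, 2)`, if there is no solution. -/
def alphaHat' {Ω : Type*} (X : ℕ → Ω → ℝ) (b : ℕ → ℝ) (n : ℕ) (ω : Ω) : ℝ :=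
  sSup {y : ℝ | 1 < y ∧ y < 2 ∧ y = G₂ (b n) (truncSecond X b n ω) y}

/-- The estimator for `α = 1`. -/
def alphaHatOne {Ω : Type*} (X : ℕ → Ω → ℝ) (b : ℕ → ℝ) (n : ℕ) (ω : Ω) : ℝ :=
  truncMean X b n ω / Real.log (b n)

/-- The estimator for `α = 2`. -/
def alphaHatTwo {Ω : Type*} (X : ℕ → Ω → ℝ) (b : ℕ → ℝ) (n : ℕ) (ω : Ω) : ℝ :=
  truncSecond X b n ω / Real.log (b n)

/-- Convergence in distribution of real random variables to the normal law `N(0, v)`. -/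
def TendstoNormal {Ω : Type*} [MeasurableSpace Ω] (P : Measure Ω) [IsProbabilityMeasure P]
    (Z : ℕ → Ω → ℝ) (v : ℝ) : Prop :=
  TendstoInDistribution Z atTop (id : ℝ → ℝ) (fun _ => P) (gaussianReal 0 v.toNNReal)

end TailIndex

end

/-! Exponentiating `x = G₁ c m x` gives `paretoTruncMean c x = m`, so the estimator is a method of
moments: the truncated sample mean is equated with its expectation under tail index `x`, and the
largest solution is taken. On a fixed interval `[p, q]` inside `(0, 1)` the logarithm of this
expectation is linear in `x` with slope `-log c`, up to a Lipschitz error whose constant `1 / (p *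
(1 - q))` does not depend on `c` (`paretoTruncMean_upper`, `abs_log_paretoTruncMean_sub_le`). For
large `c` the expectation therefore falls steeply on `[p, q]` and cannot recover on `(q, 1)`, so `m`
locates the largest root (`eventually_largestRoot_mem`), and a relative error `u` of the mean moves
the root by about `-u / log c`.

The second moment of the truncated variable is about `a / (2 - a) * c ^ (2 - a)`. Bernstein's
inequality (`truncMean_tail`), carried through the root, gives concentration; the growth condition
on `b` makes its exponent at least `2 * log n`. A central limit theorem for triangular arrays
(`tendstoNormal_row_sum`), the linearization `eventually_largestRoot_linearization` and Slutsky's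
lemma give normality. Since the mean is about `a / (1 - a) * c ^ (1 - a)`, the linearization has
slope `-(1 - a) / a` and the variance is `((1 - a) / a) ^ 2 * (a / (2 - a))`.

At index one the truncated mean has expectation `log c`, and no equation has to be inverted. Indices
in `(1, 2]` reduce to `α / 2` by squaring the sample and the truncation levels; the interval `(1,
2)` then becomes `(1 / 2, 1)`, whence the parameter `l` in `largestRoot`. -/

noncomputable section

namespace TailIndex

/-! ### The truncated Pareto mean as a function of the tail index -/

/-- The truncated mean `x / (1 - x) * (c ^ (1 - x) - 1)` of a Pareto law with tail index `x`,
truncated at level `c`. -/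
def paretoTruncMean (c x : ℝ) : ℝ := x / (1 - x) * (c ^ (1 - x) - 1)

/-- The largest solution of `x = G₁ c m x` in `(l, 1)`. -/
def largestRoot (l c m : ℝ) : ℝ := sSup {x : ℝ | l < x ∧ x < 1 ∧ x = G₁ c m x}

lemma paretoTruncMean_pos {c x : ℝ} (hc : 1 < c) (hx₀ : 0 < x) (hx₁ : x < 1) :
    0 < paretoTruncMean c x := by
  have h := Real.one_lt_rpow hc (sub_pos.2 hx₁)
  have h1 := sub_pos.2 hx₁
  exact mul_pos (div_pos hx₀ h1) (sub_pos.2 h)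

lemma continuousOn_paretoTruncMean {c : ℝ} (hc : 0 < c) :
    ContinuousOn (paretoTruncMean c) (Set.Iio 1) := by
  unfold paretoTruncMean
  refine ContinuousOn.mul (ContinuousOn.div (by fun_prop) (by fun_prop) ?_) ?_
  · intro x hx
    exact (sub_pos.2 hx).ne'
  · refine ContinuousOn.sub ?_ continuousOn_const
    exact ContinuousOn.rpow (by fun_prop) (by fun_prop) (fun x _ => Or.inl hc.ne')

lemma eq_G₁_iff {c m x : ℝ} (hc : 1 < c) (hm : 0 ≤ m) (hx₀ : 0 < x) (hx₁ : x < 1) :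
    x = G₁ c m x ↔ paretoTruncMean c x = m := by
  have h1 := sub_pos.2 hx₁
  have hL := Real.log_pos hc
  have hc0 : 0 < c := by linarith
  have harg : 0 < (1 - x) / x * m + 1 := by positivity
  have key : x = G₁ c m x ↔ Real.log ((1 - x) / x * m + 1) = (1 - x) * Real.log c := by
    unfold G₁
    constructor
    · intro h
      have : Real.log ((1 - x) / x * m + 1) / Real.log c = 1 - x := by linarith
      rwa [div_eq_iff hL.ne'] at this
    · intro h
      rw [h, mul_div_cancel_right₀ _ hL.ne']; ring
  rw [key, ← Real.log_rpow hc0]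
  unfold paretoTruncMean
  constructor
  · intro h
    have := Real.log_injOn_pos harg (Real.rpow_pos_of_pos hc0 _) h
    rw [← this]; field_simp; ring
  · intro h
    rw [← h]; congr 1; field_simp; ring

/-- Here `log c ≤ 0` pushes `G₁` up to at least `1`; at `c = 1` division by zero gives exactly `1`.
Only finitely many levels are this small, but measurability is needed for every `n`. -/
lemma eq_G₁_false {c m x : ℝ} (hc₀ : 0 < c) (hc : c ≤ 1) (hm : 0 ≤ m) (hx₀ : 0 < x)
    (hx₁ : x < 1) : x ≠ G₁ c m x := by
  have h1 := sub_pos.2 hx₁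
  have h2 : 0 ≤ Real.log ((1 - x) / x * m + 1) :=
    Real.log_nonneg (by have : 0 ≤ (1 - x) / x * m := by positivity
                        linarith)
  have h3 : Real.log ((1 - x) / x * m + 1) / Real.log c ≤ 0 :=
    div_nonpos_of_nonneg_of_nonpos h2 (Real.log_nonpos hc₀.le hc)
  unfold G₁
  intro h
  linarith

/-- `(1 - exp (-u L)) / u` is antitone and `(exp (u L) - 1) / u` is monotone in `u`. -/
lemma div_mul_exp_sub_one_le {u v L : ℝ} (hu : 0 < u) (huv : u ≤ v) :
    Real.exp (u * L) - 1 ≤ u / v * (Real.exp (v * L) - 1) := by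
  have hv : 0 < v := by linarith
  have h := convexOn_exp.2 (Set.mem_univ (0 : ℝ)) (Set.mem_univ (v * L))
    (sub_nonneg.2 ((div_le_one hv).2 huv) : 0 ≤ 1 - u / v) (by positivity : 0 ≤ u / v) (by ring)
  have h2 : (1 - u / v) • (0 : ℝ) + (u / v) • (v * L) = u * L := by
    simp only [smul_eq_mul]; field_simp; ring
  rw [h2] at h
  simp only [smul_eq_mul, Real.exp_zero] at h
  linarith

lemma rpow_eq_exp_mul_log {c : ℝ} (hc : 0 < c) (x : ℝ) : c ^ x = Real.exp (x * Real.log c) := by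
  rw [Real.rpow_def_of_pos hc, mul_comm]

/-- In `c ^ (1 - z) - 1 = c ^ (1 - z) * (1 - c ^ (-(1 - z)))` the first factor decays at rate
exactly `log c` in `z`; what remains, including `z / (1 - z)`, is increasing in `z`. -/
lemma paretoTruncMean_lower {c x y : ℝ} (hc : 1 < c) (hy : 0 < y) (hyx : y ≤ x) (hx : x < 1) :
    paretoTruncMean c y * Real.exp (-((x - y) * Real.log c)) ≤ paretoTruncMean c x := by
  have hc0 : 0 < c := by linarith
  have hx1 := sub_pos.2 hx
  have hy1 : 0 < 1 - y := by linarith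
  have hx0 : 0 < x := by linarith
  set L := Real.log c
  have e1 : ∀ z : ℝ, c ^ (1 - z) - 1 = Real.exp ((1 - z) * L) * (1 - Real.exp ((1 - z) * -L)) := by
    intro z
    rw [rpow_eq_exp_mul_log hc0, mul_sub, ← Real.exp_add]
    simp [L]
  have e2 : Real.exp ((1 - y) * L) * Real.exp (-((x - y) * L)) = Real.exp ((1 - x) * L) := by
    rw [← Real.exp_add]; congr 1; ring
  have h := div_mul_exp_sub_one_le (L := -L) hx1 (by linarith : 1 - x ≤ 1 - y)
  unfold paretoTruncMean
  rw [e1, e1]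
  have hE := Real.exp_pos ((1 - x) * L)
  have hk : (1 - Real.exp ((1 - y) * -L)) / (1 - y) ≤ (1 - Real.exp ((1 - x) * -L)) / (1 - x) := by
    rw [div_le_div_iff₀ hy1 hx1]
    have : (Real.exp ((1 - x) * -L) - 1) * (1 - y)
        ≤ (1 - x) * (Real.exp ((1 - y) * -L) - 1) := by
      calc _ ≤ (1 - x) / (1 - y) * (Real.exp ((1 - y) * -L) - 1) * (1 - y) := by gcongr
        _ = _ := by field_simp
    linarith
  have hn : 0 ≤ (1 - Real.exp ((1 - y) * -L)) / (1 - y) := by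
    refine div_nonneg ?_ hy1.le
    have : Real.exp ((1 - y) * -L) ≤ 1 := by
      apply Real.exp_le_one_iff.2
      have := Real.log_pos hc
      nlinarith
    linarith
  calc _ = y * ((1 - Real.exp ((1 - y) * -L)) / (1 - y)) *
        (Real.exp ((1 - y) * L) * Real.exp (-((x - y) * L))) := by ring
    _ = y * ((1 - Real.exp ((1 - y) * -L)) / (1 - y)) * Real.exp ((1 - x) * L) := by rw [e2]
    _ ≤ x * ((1 - Real.exp ((1 - x) * -L)) / (1 - x)) * Real.exp ((1 - x) * L) := by gcongr
    _ = _ := by ring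

/-- The factor `c ^ (1 - x) - 1` decays at least at rate `log c`, while `x / (1 - x)` grows at
exponential rate at most `1 / (p * (1 - q))`. -/
lemma paretoTruncMean_upper {c x y p q : ℝ} (hc : 1 < c) (hp : 0 < p) (hpy : p ≤ y) (hyx : y ≤ x)
    (hxq : x ≤ q) (hq : q < 1) :
    paretoTruncMean c x ≤
      paretoTruncMean c y * Real.exp (-((x - y) * (Real.log c - 1 / (p * (1 - q))))) := by
  have hc0 : 0 < c := by linarith
  have hy : 0 < y := by linarith
  have hq1 := sub_pos.2 hq
  have hx1 : 0 < 1 - x := by linarith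
  have hy1 : 0 < 1 - y := by linarith
  set L := Real.log c
  have hL : 0 < L := Real.log_pos hc
  have h1 : c ^ (1 - x) - 1 ≤ (c ^ (1 - y) - 1) * Real.exp (-((x - y) * L)) := by
    rw [rpow_eq_exp_mul_log hc0, rpow_eq_exp_mul_log hc0, sub_mul _ (1 : ℝ), ← Real.exp_add, one_mul]
    have : (1 - y) * L + -((x - y) * L) = (1 - x) * L := by ring
    rw [this]
    have : Real.exp (-((x - y) * L)) ≤ 1 := by
      apply Real.exp_le_one_iff.2
      have : 0 ≤ (x - y) * L := mul_nonneg (by linarith) hL.le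
      linarith
    linarith
  have h2 : x / (1 - x) ≤ y / (1 - y) * Real.exp ((x - y) * (1 / (p * (1 - q)))) := by
    have h3 : x / (1 - x) = y / (1 - y) * (1 + (x - y) * (1 / (y * (1 - x)))) := by
      field_simp; ring
    rw [h3]
    have h4 : (x - y) * (1 / (y * (1 - x))) ≤ (x - y) * (1 / (p * (1 - q))) := by
      have : 0 ≤ x - y := by linarith
      gcongr
    have h5 := Real.add_one_le_exp ((x - y) * (1 / (p * (1 - q))))
    have : 0 ≤ y / (1 - y) := by positivity
    gcongr
    linarith
  have h6 : 0 ≤ c ^ (1 - x) - 1 := sub_nonneg.2 (Real.one_le_rpow hc.le hx1.le)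
  unfold paretoTruncMean
  calc x / (1 - x) * (c ^ (1 - x) - 1)
      ≤ (y / (1 - y) * Real.exp ((x - y) * (1 / (p * (1 - q))))) *
        ((c ^ (1 - y) - 1) * Real.exp (-((x - y) * L))) := by gcongr
    _ = y / (1 - y) * (c ^ (1 - y) - 1) *
        (Real.exp ((x - y) * (1 / (p * (1 - q)))) * Real.exp (-((x - y) * L))) := by ring
    _ = _ := by rw [← Real.exp_add]; congr 2; ring

/-- Covers indices close to `1`, where the constant of `paretoTruncMean_upper` blows up: `(c ^ (1 -
x) - 1) / (1 - x)` is antitone in `x`, and the factor `x` is at most `1`. -/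
lemma paretoTruncMean_le_div {c x q : ℝ} (hc : 1 < c) (hq : 0 < q) (hqx : q ≤ x) (hx : x < 1) :
    paretoTruncMean c x ≤ paretoTruncMean c q / q := by
  have hc0 : 0 < c := by linarith
  have hx1 := sub_pos.2 hx
  have hq1 : 0 < 1 - q := by linarith
  have h := div_mul_exp_sub_one_le (L := Real.log c) hx1 (by linarith : 1 - x ≤ 1 - q)
  rw [← rpow_eq_exp_mul_log hc0, ← rpow_eq_exp_mul_log hc0] at h
  have h6 : 0 ≤ c ^ (1 - q) - 1 := sub_nonneg.2 (Real.one_le_rpow hc.le hq1.le)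
  unfold paretoTruncMean
  calc x / (1 - x) * (c ^ (1 - x) - 1) ≤
      x / (1 - x) * ((1 - x) / (1 - q) * (c ^ (1 - q) - 1)) := by
        have : 0 < x := by linarith
        gcongr
    _ = x * ((c ^ (1 - q) - 1) / (1 - q)) := by field_simp
    _ ≤ 1 * ((c ^ (1 - q) - 1) / (1 - q)) := by gcongr
    _ = _ := by field_simp

/-- For large truncation levels, a value between the truncated means at two tail indices determines
a largest root, which lies between the two indices. -/
lemma eventually_largestRoot_mem {l p r q : ℝ} (hl : 0 ≤ l) (hlp : l < p) (hpr : p ≤ r)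
    (hrq : r < q) (hq : q < 1) :
    ∀ᶠ c : ℝ in atTop, ∀ y₁ y₂ m : ℝ, p ≤ y₁ → y₁ < y₂ → y₂ ≤ r →
      paretoTruncMean c y₂ < m → m < paretoTruncMean c y₁ →
      y₁ < largestRoot l c m ∧ largestRoot l c m < y₂ ∧
        paretoTruncMean c (largestRoot l c m) = m := by
  have hp : 0 < p := by linarith
  have hq0 : 0 < q := by linarith
  set C := 1 / (p * (1 - q)) with hC
  have hT : Tendsto (fun c : ℝ => (q - r) * (Real.log c - C)) atTop atTop := by
    refine Tendsto.const_mul_atTop (by linarith) ?_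
    exact tendsto_atTop_add_const_right _ _ Real.tendsto_log_atTop
  -- The drop between `r` and `q` must beat the loss `1 / q` allowed by `paretoTruncMean_le_div`.
  have hexp := (Real.tendsto_exp_neg_atTop_nhds_zero.comp hT).eventually (gt_mem_nhds hq0)
  filter_upwards [eventually_gt_atTop 1, hexp,
    Real.tendsto_log_atTop.eventually (eventually_gt_atTop C)] with c hc hE hLC
  intro y₁ y₂ m h1 h12 h2 hm2 hm1
  simp only [Function.comp] at hE
  have hc0 : 0 < c := by linarith
  have hm : 0 < m := (paretoTruncMean_pos hc (by linarith) (by linarith)).trans hm2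
  obtain ⟨x₀, hx₀, hx₀m⟩ : m ∈ paretoTruncMean c '' Set.Ioo y₁ y₂ := by
    refine intermediate_value_Ioo' h12.le ?_ ⟨hm2, hm1⟩
    refine (continuousOn_paretoTruncMean hc0).mono ?_
    intro x hx
    exact lt_of_le_of_lt hx.2 (by linarith)
  have hgreat : IsGreatest {x : ℝ | l < x ∧ x < 1 ∧ x = G₁ c m x} x₀ := by
    have hxl : l < x₀ := by linarith [hx₀.1]
    have hx1 : x₀ < 1 := by linarith [hx₀.2]
    refine ⟨⟨hxl, hx1, (eq_G₁_iff hc hm.le (by linarith) hx1).2 hx₀m⟩, ?_⟩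
    rintro x ⟨hx, hx', hxG⟩
    rw [eq_G₁_iff hc hm.le (by linarith) hx'] at hxG
    by_contra! hlt
    -- No solution lies to the right of `x₀`: up to `q` the truncated mean is strictly below `m`,
    -- and at `q` it is already below `m * q`, which keeps it below `m` on `(q, 1)`.
    have hlow : ∀ z, x₀ < z → z ≤ q → paretoTruncMean c z ≤
        m * Real.exp (-((z - x₀) * (Real.log c - C))) := by
      intro z hz hzq
      rw [← hx₀m]
      exact paretoTruncMean_upper hc hp (by linarith [hx₀.1]) hz.le hzq hq
    rcases le_or_gt x q with hxq | hxq
    · have h3 := hlow x hlt hxq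
      rw [hxG] at h3
      have h4 : Real.exp (-((x - x₀) * (Real.log c - C))) < 1 := by
        apply Real.exp_lt_one_iff.2
        have : 0 < (x - x₀) * (Real.log c - C) := mul_pos (by linarith) (by linarith)
        linarith
      have := mul_lt_mul_of_pos_left h4 hm
      linarith
    · have h3 := hlow q (by linarith [hx₀.2]) le_rfl
      have h4 := paretoTruncMean_le_div hc hq0 hxq.le hx'
      rw [hxG, le_div_iff₀ hq0] at h4
      have h5 : Real.exp (-((q - x₀) * (Real.log c - C))) < q := by
        refine lt_of_le_of_lt (Real.exp_le_exp.2 ?_) hE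
        have : (q - r) * (Real.log c - C) ≤ (q - x₀) * (Real.log c - C) :=
          mul_le_mul_of_nonneg_right (by linarith [hx₀.2]) (by linarith)
        linarith
      have := mul_lt_mul_of_pos_left h5 hm
      linarith
  have hs : largestRoot l c m = x₀ := hgreat.csSup_eq
  rw [hs]
  exact ⟨hx₀.1, hx₀.2, hx₀m⟩

/-! ### Measurability -/

/-- For `a ≥ 0`, the root exceeds `a` exactly when `max m 0` lies in the image of an interval under
the continuous `paretoTruncMean c`, again an interval. The truncation of `m` at `0` is harmless,
since sample means are almost surely nonnegative. -/
lemma measurable_largestRoot_max {l c : ℝ} (hl : 0 ≤ l) (hc : 0 < c) :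
    Measurable fun m : ℝ => largestRoot l c (max m 0) := by
  rcases le_or_gt c 1 with hc1 | hc1
  · have : (fun m : ℝ => largestRoot l c (max m 0)) = fun _ => 0 := by
      funext m
      have : {x : ℝ | l < x ∧ x < 1 ∧ x = G₁ c (max m 0) x} = ∅ := by
        ext x
        simp only [Set.mem_ofPred_eq, Set.mem_empty_iff_false, iff_false]
        rintro ⟨h1, h2, h3⟩
        exact eq_G₁_false hc hc1 (le_max_right _ _) (by linarith) h2 h3
      simp only [largestRoot, this, Real.sSup_empty]
    rw [this]
    exact measurable_const
  · refine measurable_of_Ioi fun a => ?_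
    rcases lt_or_ge a 0 with ha | ha
    · convert! MeasurableSet.univ
      ext m
      simp only [Set.mem_preimage, Set.mem_Ioi, Set.mem_univ, iff_true]
      refine ha.trans_le (Real.sSup_nonneg ?_)
      rintro x ⟨hx, -⟩
      linarith
    · have hset : (fun m : ℝ => largestRoot l c (max m 0)) ⁻¹' Set.Ioi a =
          (fun m : ℝ => max m 0) ⁻¹' (paretoTruncMean c '' Set.Ioo (max l a) 1) := by
        ext m
        simp only [Set.mem_preimage, Set.mem_Ioi, Set.mem_image, Set.mem_Ioo]
        constructor
        · intro h
          have hne : {x : ℝ | l < x ∧ x < 1 ∧ x = G₁ c (max m 0) x}.Nonempty := by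
            rw [Set.nonempty_iff_ne_empty]
            intro he
            simp only [largestRoot, he, Real.sSup_empty] at h
            linarith
          obtain ⟨x, ⟨hx1, hx2, hx3⟩, hxa⟩ := exists_lt_of_lt_csSup hne h
          exact ⟨x, ⟨max_lt hx1 hxa, hx2⟩,
            (eq_G₁_iff hc1 (le_max_right _ _) (by linarith) hx2).1 hx3⟩
        · rintro ⟨x, ⟨hx1, hx2⟩, hx3⟩
          have hx := max_lt_iff.1 hx1
          refine hx.2.trans_le (le_csSup ⟨1, fun z hz => hz.2.1.le⟩ ⟨hx.1, hx2, ?_⟩)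
          exact (eq_G₁_iff hc1 (le_max_right _ _) (by linarith) hx2).2 hx3
      rw [hset]
      refine (measurable_id.max measurable_const) ?_
      refine Set.OrdConnected.measurableSet ?_
      refine IsPreconnected.ordConnected ?_
      refine isPreconnected_Ioo.image _ ?_
      exact (continuousOn_paretoTruncMean hc).mono fun x hx => hx.2

lemma measurable_trunc (c : ℝ) : Measurable (trunc c) :=
  Measurable.ite measurableSet_Iic measurable_id measurable_const

lemma trunc_nonneg {c x : ℝ} (hx : 0 ≤ x) : 0 ≤ trunc c x := by
  unfold trunc; split_ifs <;> simp [hx]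

lemma trunc_le {c x : ℝ} (hc : 0 ≤ c) : trunc c x ≤ c := by
  unfold trunc; split_ifs <;> simp [*]

/-! ### Bernstein's inequality with second moments -/

section Bernstein

/-- Multiply by `3 - u`. The difference `3 + 2 * u + u ^ 2 / 2 - (3 - u) * exp u` and its derivative
vanish at `0`, and its second derivative `1 - (1 - u) * exp u` is nonnegative. -/
lemma exp_le_bernstein {u : ℝ} (hu : 0 ≤ u) (hu3 : u < 3) :
    Real.exp u ≤ 1 + u + u ^ 2 / (2 * (1 - u / 3)) := by
  have hd1 : ∀ x : ℝ, HasDerivAt (fun x : ℝ => 2 + x - (2 - x) * Real.exp x)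
      (1 - (1 - x) * Real.exp x) x := by
    intro x
    have := ((hasDerivAt_id x).const_add 2).sub
      (((hasDerivAt_id x).const_sub 2).mul (Real.hasDerivAt_exp x))
    convert! this using 1
    simp; ring
  have hm1 : Monotone fun x : ℝ => 2 + x - (2 - x) * Real.exp x := by
    refine monotone_of_deriv_nonneg (fun x => (hd1 x).differentiableAt) fun x => ?_
    rw [(hd1 x).deriv]
    have h1 := Real.add_one_le_exp (-x)
    have h2 : Real.exp (-x) * Real.exp x = 1 := by rw [← Real.exp_add]; simp
    have := mul_le_mul_of_nonneg_right h1 (Real.exp_pos x).le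
    linarith
  have hd2 : ∀ x : ℝ, HasDerivAt (fun x : ℝ => 3 + 2 * x + x ^ 2 / 2 - (3 - x) * Real.exp x)
      (2 + x - (2 - x) * Real.exp x) x := by
    intro x
    have := ((((hasDerivAt_id x).const_mul 2).const_add 3).add
      (((hasDerivAt_id x).pow 2).div_const 2)).sub
      (((hasDerivAt_id x).const_sub 3).mul (Real.hasDerivAt_exp x))
    convert! this using 1
    simp; ring
  have hm2 : MonotoneOn (fun x : ℝ => 3 + 2 * x + x ^ 2 / 2 - (3 - x) * Real.exp x)
      (Set.Ici 0) := by
    refine monotoneOn_of_deriv_nonneg (convex_Ici 0)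
      (fun x _ => (hd2 x).continuousAt.continuousWithinAt)
      (fun x _ => (hd2 x).differentiableAt.differentiableWithinAt) fun x hx => ?_
    rw [(hd2 x).deriv]
    rw [interior_Ici] at hx
    have := hm1 (le_of_lt hx : (0 : ℝ) ≤ x)
    simpa using this
  have h := hm2 (Set.mem_Ici.2 le_rfl) (Set.mem_Ici.2 hu) hu
  simp only [mul_zero, add_zero, sub_zero, Real.exp_zero, mul_one] at h
  have h3 : 0 < 3 - u := by linarith
  have h4 : 1 + u + u ^ 2 / (2 * (1 - u / 3)) = (3 + 2 * u + u ^ 2 / 2) / (3 - u) := by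
    have : 1 - u / 3 ≠ 0 := by linarith
    field_simp
    ring
  rw [h4, le_div_iff₀ h3]
  norm_num at h
  linarith

lemma exp_neg_le_quadratic {u : ℝ} (hu : 0 ≤ u) : Real.exp (-u) ≤ 1 - u + u ^ 2 / 2 := by
  have hd : ∀ x : ℝ, HasDerivAt (fun x : ℝ => 1 - x + x ^ 2 / 2 - Real.exp (-x))
      (-1 + x + Real.exp (-x)) x := by
    intro x
    have := (((hasDerivAt_id x).const_sub 1).add
      (((hasDerivAt_id x).pow 2).div_const 2)).sub ((hasDerivAt_id x).neg.exp)
    convert! this using 1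
    simp
  have hm : Monotone (fun x : ℝ => 1 - x + x ^ 2 / 2 - Real.exp (-x)) := by
    refine monotone_of_deriv_nonneg (fun x => (hd x).differentiableAt) fun x => ?_
    rw [(hd x).deriv]
    linarith [Real.add_one_le_exp (-x)]
  have := hm hu
  simp at this
  linarith

variable {Ω : Type*} [MeasurableSpace Ω] {P : Measure Ω} [IsProbabilityMeasure P]

lemma integrable_of_ae_mem {f : Ω → ℝ} (hf : AEMeasurable f P) {M : ℝ}
    (hM : ∀ᵐ ω ∂P, |f ω| ≤ M) : Integrable f P :=
  Integrable.of_bound hf.aestronglyMeasurable M (by simpa using hM)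

lemma integral_quadratic {Z : Ω → ℝ} (hi1 : Integrable Z P)
    (hi2 : Integrable (fun ω => Z ω ^ 2) P) (p q : ℝ) :
    ∫ ω, (1 + p * Z ω + q * Z ω ^ 2) ∂P = 1 + p * (∫ ω, Z ω ∂P) + q * ∫ ω, Z ω ^ 2 ∂P := by
  have hp : Integrable (fun ω => p * Z ω) P := hi1.const_mul _
  have hq : Integrable (fun ω => q * Z ω ^ 2) P := hi2.const_mul _
  have h1 : Integrable (fun ω => 1 + p * Z ω) P := (integrable_const _).add hp
  rw [integral_add h1 hq, integral_add (integrable_const _) hp, integral_const_mul,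
    integral_const_mul]
  simp

/-- Nonnegativity lets the pointwise bound apply to `Z` without centring; the uncentred second
moment then plays the role of the variance. -/
lemma mgf_le_bernstein {Z : Ω → ℝ} (hZ : AEMeasurable Z P) {M V s : ℝ}
    (hZM : ∀ᵐ ω ∂P, 0 ≤ Z ω ∧ Z ω ≤ M) (hV : ∫ ω, Z ω ^ 2 ∂P ≤ V) (hs : 0 ≤ s)
    (hsM : s * M < 3) :
    mgf Z P s ≤ Real.exp (s * ∫ ω, Z ω ∂P + s ^ 2 * V / (2 * (1 - s * M / 3))) := by
  have hi1 : Integrable Z P := integrable_of_ae_mem hZ (M := M) <| by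
    filter_upwards [hZM] with ω h
    rw [abs_of_nonneg h.1]; exact h.2
  have hi2 : Integrable (fun ω => Z ω ^ 2) P :=
    integrable_of_ae_mem (hZ.pow_const 2) (M := M ^ 2) <| by
      filter_upwards [hZM] with ω h
      rw [abs_of_nonneg (by positivity)]; exact pow_le_pow_left₀ h.1 h.2 2
  have hd : 0 < 2 * (1 - s * M / 3) := by linarith
  set D := 2 * (1 - s * M / 3)
  calc mgf Z P s = ∫ ω, Real.exp (s * Z ω) ∂P := rfl
    _ ≤ ∫ ω, (1 + s * Z ω + s ^ 2 / D * Z ω ^ 2) ∂P := by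
        refine integral_mono_of_nonneg (ae_of_all _ fun ω => (Real.exp_pos _).le) ?_ ?_
        · exact ((integrable_const _).add (hi1.const_mul _)).add (hi2.const_mul _)
        · filter_upwards [hZM] with ω h
          have h1 : s * Z ω ≤ s * M := mul_le_mul_of_nonneg_left h.2 hs
          have h2 := exp_le_bernstein (mul_nonneg hs h.1) (by linarith)
          refine h2.trans ?_
          have : (s * Z ω) ^ 2 / (2 * (1 - s * Z ω / 3)) ≤ (s * Z ω) ^ 2 / D :=
            div_le_div_of_nonneg_left (by positivity) hd (by simp only [D]; linarith)
          calc _ ≤ 1 + s * Z ω + (s * Z ω) ^ 2 / D := by linarith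
            _ = _ := by ring
    _ = 1 + s * (∫ ω, Z ω ∂P) + s ^ 2 / D * ∫ ω, Z ω ^ 2 ∂P := by
        exact integral_quadratic hi1 hi2 _ _
    _ ≤ 1 + s * (∫ ω, Z ω ∂P) + s ^ 2 / D * V := by gcongr
    _ = (s * (∫ ω, Z ω ∂P) + s ^ 2 * V / D) + 1 := by ring
    _ ≤ _ := Real.add_one_le_exp _

/-- For the lower tail, `exp_neg_le_quadratic` holds on the whole half-line, so the bound is
sub-Gaussian: `M` serves only for integrability. -/
lemma mgf_neg_le {Z : Ω → ℝ} (hZ : AEMeasurable Z P) {M V s : ℝ}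
    (hZM : ∀ᵐ ω ∂P, 0 ≤ Z ω ∧ Z ω ≤ M) (hV : ∫ ω, Z ω ^ 2 ∂P ≤ V) (hs : 0 ≤ s) :
    mgf Z P (-s) ≤ Real.exp (-s * ∫ ω, Z ω ∂P + s ^ 2 * V / 2) := by
  have hi1 : Integrable Z P := integrable_of_ae_mem hZ (M := M) <| by
    filter_upwards [hZM] with ω h
    rw [abs_of_nonneg h.1]; exact h.2
  have hi2 : Integrable (fun ω => Z ω ^ 2) P :=
    integrable_of_ae_mem (hZ.pow_const 2) (M := M ^ 2) <| by
      filter_upwards [hZM] with ω h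
      rw [abs_of_nonneg (by positivity)]; exact pow_le_pow_left₀ h.1 h.2 2
  calc mgf Z P (-s) = ∫ ω, Real.exp (-s * Z ω) ∂P := rfl
    _ ≤ ∫ ω, (1 + -s * Z ω + s ^ 2 / 2 * Z ω ^ 2) ∂P := by
        refine integral_mono_of_nonneg (ae_of_all _ fun ω => (Real.exp_pos _).le) ?_ ?_
        · exact ((integrable_const _).add (hi1.const_mul _)).add (hi2.const_mul _)
        · filter_upwards [hZM] with ω h
          have h2 := exp_neg_le_quadratic (mul_nonneg hs h.1)
          rw [neg_mul]
          refine h2.trans (le_of_eq ?_)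
          ring
    _ = 1 + -s * (∫ ω, Z ω ∂P) + s ^ 2 / 2 * ∫ ω, Z ω ^ 2 ∂P := by
        exact integral_quadratic hi1 hi2 _ _
    _ ≤ 1 + -s * (∫ ω, Z ω ∂P) + s ^ 2 / 2 * V := by gcongr
    _ = (-s * (∫ ω, Z ω ∂P) + s ^ 2 * V / 2) + 1 := by ring
    _ ≤ _ := Real.add_one_le_exp _

variable {Z : ℕ → Ω → ℝ}

lemma integrable_exp_mul_sum (hZ : ∀ k, AEMeasurable (Z k) P) {M : ℝ}
    (hZM : ∀ k, ∀ᵐ ω ∂P, 0 ≤ Z k ω ∧ Z k ω ≤ M) (n : ℕ) (s : ℝ) :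
    Integrable (fun ω => Real.exp (s * (∑ k ∈ Finset.range n, Z k) ω)) P := by
  have hm : AEMeasurable (fun ω => Real.exp (s * (∑ k ∈ Finset.range n, Z k) ω)) P :=
    Real.measurable_exp.comp_aemeasurable
      ((Finset.aemeasurable_sum _ fun k _ => hZ k).const_mul s)
  refine integrable_of_ae_mem hm (M := Real.exp (|s| * (n * M))) ?_
  filter_upwards [ae_all_iff.2 hZM] with ω h
  rw [abs_of_pos (Real.exp_pos _)]
  refine Real.exp_le_exp.2 ?_
  rw [Finset.sum_apply]
  have h0 : 0 ≤ ∑ k ∈ Finset.range n, Z k ω := Finset.sum_nonneg fun k _ => (h k).1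
  have h1 : ∑ k ∈ Finset.range n, Z k ω ≤ n * M := by
    refine (Finset.sum_le_sum fun k _ => (h k).2).trans (by simp)
  calc _ ≤ |s| * ∑ k ∈ Finset.range n, Z k ω := by
        exact mul_le_mul_of_nonneg_right (le_abs_self s) h0
    _ ≤ _ := by gcongr

/-- **Bernstein's inequality** for the upper tail of a sum of nonnegative bounded variables, in
terms of the second moment. -/
lemma measure_sum_ge_le_bernstein (hZ : ∀ k, AEMeasurable (Z k) P) (hindep : iIndepFun Z P)
    (hident : ∀ k, IdentDistrib (Z k) (Z 0) P P) {M V t : ℝ} (hM : 0 < M)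
    (hZM : ∀ k, ∀ᵐ ω ∂P, 0 ≤ Z k ω ∧ Z k ω ≤ M) (hV : ∫ ω, Z 0 ω ^ 2 ∂P ≤ V) (hV₀ : 0 < V)
    (ht : 0 < t) (n : ℕ) :
    P.real {ω | n * ((∫ ω, Z 0 ω ∂P) + t) ≤ ∑ k ∈ Finset.range n, Z k ω} ≤
      Real.exp (-(n * (t ^ 2 / (2 * (V + M * t / 3))))) := by
  set μ := ∫ ω, Z 0 ω ∂P
  set U := V + M * t / 3 with hU
  have hU0 : 0 < U := by positivity
  -- With this `s`, `1 - s * M / 3 = V / U`, and the exponent collapses to `-n * t ^ 2 / (2 * U)`.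
  set s := t / U with hs
  have hs0 : 0 < s := by positivity
  have hsM : s * M < 3 := by
    rw [hs, div_mul_eq_mul_div, div_lt_iff₀ hU0]; rw [hU]; nlinarith
  have h := measure_ge_le_exp_mul_mgf (n * (μ + t)) hs0.le (integrable_exp_mul_sum hZ hZM n s)
  rw [hindep.mgf_sum₀ hZ, Finset.prod_congr rfl fun k _ =>
    mgf_congr_of_identDistrib (Z k) (Z 0) (hident k) s, Finset.prod_const, Finset.card_range] at h
  simp only [Finset.sum_apply] at h
  refine h.trans ?_
  calc Real.exp (-s * (n * (μ + t))) * mgf (Z 0) P s ^ n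
      ≤ Real.exp (-s * (n * (μ + t))) *
        Real.exp (s * μ + s ^ 2 * V / (2 * (1 - s * M / 3))) ^ n := by
        gcongr
        · exact mgf_nonneg
        · exact mgf_le_bernstein (hZ 0) (hZM 0) hV hs0.le hsM
    _ = Real.exp (-(n * (t ^ 2 / (2 * U)))) := by
        rw [← Real.exp_nat_mul, ← Real.exp_add]
        congr 1
        have h1 : 1 - s * M / 3 = V / U := by
          rw [hs]; field_simp; rw [hU]; ring
        rw [h1, hs]
        field_simp
        ring

lemma measure_sum_le_le_bernstein (hZ : ∀ k, AEMeasurable (Z k) P) (hindep : iIndepFun Z P)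
    (hident : ∀ k, IdentDistrib (Z k) (Z 0) P P) {M V t : ℝ}
    (hZM : ∀ k, ∀ᵐ ω ∂P, 0 ≤ Z k ω ∧ Z k ω ≤ M) (hV : ∫ ω, Z 0 ω ^ 2 ∂P ≤ V) (hV₀ : 0 < V)
    (ht : 0 < t) (n : ℕ) :
    P.real {ω | ∑ k ∈ Finset.range n, Z k ω ≤ n * ((∫ ω, Z 0 ω ∂P) - t)} ≤
      Real.exp (-(n * (t ^ 2 / (2 * V)))) := by
  set μ := ∫ ω, Z 0 ω ∂P
  -- The minimizer of `-s * t + s ^ 2 * V / 2`.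
  set s := t / V with hs
  have hs0 : 0 < s := by positivity
  have h := measure_le_le_exp_mul_mgf (n * (μ - t)) (neg_nonpos.2 hs0.le)
    (integrable_exp_mul_sum hZ hZM n (-s))
  rw [hindep.mgf_sum₀ hZ, Finset.prod_congr rfl fun k _ =>
    mgf_congr_of_identDistrib (Z k) (Z 0) (hident k) (-s), Finset.prod_const,
    Finset.card_range] at h
  simp only [Finset.sum_apply] at h
  refine h.trans ?_
  calc Real.exp (-(-s) * (n * (μ - t))) * mgf (Z 0) P (-s) ^ n
      ≤ Real.exp (-(-s) * (n * (μ - t))) * Real.exp (-s * μ + s ^ 2 * V / 2) ^ n := by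
        gcongr
        · exact mgf_nonneg
        · exact mgf_neg_le (hZ 0) (hZM 0) hV hs0.le
    _ = Real.exp (-(n * (t ^ 2 / (2 * V)))) := by
        rw [← Real.exp_nat_mul, ← Real.exp_add]
        congr 1
        rw [hs]
        field_simp
        ring

end Bernstein

/-! ### A central limit theorem for bounded triangular arrays -/

section Rows

variable {Ω : Type*} [MeasurableSpace Ω] {P : Measure Ω} [IsProbabilityMeasure P]

lemma norm_exp_mul_I_sub_quadratic_le {u : ℝ} (hu : |u| ≤ 1) :
    ‖Complex.exp (u * Complex.I) - (1 + u * Complex.I - u ^ 2 / 2)‖ ≤ |u| * u ^ 2 := by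
  have hn : ‖(u : ℂ) * Complex.I‖ = |u| := by simp
  have h := Complex.exp_bound (x := (u : ℂ) * Complex.I) (by rw [hn]; exact hu)
    (n := 3) (by norm_num)
  rw [hn] at h
  have hs : ∑ m ∈ Finset.range 3, ((u : ℂ) * Complex.I) ^ m / (m.factorial : ℂ) =
      1 + u * Complex.I - u ^ 2 / 2 := by
    simp [Finset.sum_range_succ, mul_pow]
    ring
  rw [hs] at h
  refine h.trans ?_
  have h3 : |u| ^ 3 = |u| * u ^ 2 := by rw [pow_succ', sq_abs]
  rw [h3]
  have : ((3 : ℕ).succ : ℝ) * ((Nat.factorial 3 : ℝ) * (3 : ℕ))⁻¹ ≤ 1 := by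
    norm_num [Nat.factorial]
  calc _ ≤ |u| * u ^ 2 * 1 := by gcongr
    _ = _ := by ring

/-- The cubic Taylor remainder `|t * Z| ^ 3` is at most `|t| * η * (t * Z) ^ 2`, so a uniform bound
replaces a third moment or Lindeberg condition. -/
lemma norm_charFun_sub_quadratic_le {Z : Ω → ℝ} (hZ : AEMeasurable Z P) {η : ℝ}
    (hη : ∀ᵐ ω ∂P, |Z ω| ≤ η) (h0 : ∫ ω, Z ω ∂P = 0) {t : ℝ} (ht : |t| * η ≤ 1) :
    ‖charFun (P.map Z) t - 1 + t ^ 2 / 2 * ((∫ ω, Z ω ^ 2 ∂P : ℝ) : ℂ)‖ ≤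
      |t| * η * t ^ 2 * ∫ ω, Z ω ^ 2 ∂P := by
  have hi1 : Integrable Z P := integrable_of_ae_mem hZ hη
  have hi2 : Integrable (fun ω => Z ω ^ 2) P :=
    integrable_of_ae_mem (hZ.pow_const 2) (M := η ^ 2) <| by
      filter_upwards [hη] with ω h
      rw [abs_pow]; exact pow_le_pow_left₀ (abs_nonneg _) h 2
  have hie : Integrable (fun ω => Complex.exp ((t * Z ω : ℝ) * Complex.I)) P := by
    refine Integrable.of_bound ?_ 1 ?_
    · refine AEMeasurable.aestronglyMeasurable ?_
      fun_prop
    · exact ae_of_all _ fun ω => by rw [Complex.norm_exp_ofReal_mul_I]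
  have hi1' : Integrable (fun ω => ((t * Z ω : ℝ) : ℂ) * Complex.I) P :=
    ((hi1.const_mul t).ofReal).mul_const _
  have hi2' : Integrable (fun ω => ((t * Z ω : ℝ) : ℂ) ^ 2 / 2) P := by
    have : Integrable (fun ω => (((t ^ 2 / 2) * Z ω ^ 2 : ℝ) : ℂ)) P := (hi2.const_mul _).ofReal
    refine this.congr (ae_of_all _ fun ω => ?_)
    push_cast; ring
  have hi3 : Integrable (fun ω => 1 + ((t * Z ω : ℝ) : ℂ) * Complex.I) P :=
    (integrable_const _).add hi1'
  have hchar : charFun (P.map Z) t = ∫ ω, Complex.exp ((t * Z ω : ℝ) * Complex.I) ∂P := by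
    rw [charFun_apply_real, integral_map hZ (by fun_prop)]
    simp
  have e1 : ∫ ω, ((t * Z ω : ℝ) : ℂ) * Complex.I ∂P = 0 := by
    rw [integral_mul_const, integral_complex_ofReal, integral_const_mul, h0]
    simp
  have e2 : ∫ ω, ((t * Z ω : ℝ) : ℂ) ^ 2 / 2 ∂P = t ^ 2 / 2 * ((∫ ω, Z ω ^ 2 ∂P : ℝ) : ℂ) := by
    rw [← integral_complex_ofReal, ← integral_const_mul]
    refine integral_congr_ae (ae_of_all _ fun ω => ?_)
    simp only []
    push_cast; ring
  have hsplit : charFun (P.map Z) t - 1 + t ^ 2 / 2 * ((∫ ω, Z ω ^ 2 ∂P : ℝ) : ℂ) =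
      ∫ ω, (Complex.exp ((t * Z ω : ℝ) * Complex.I) -
        (1 + ((t * Z ω : ℝ) : ℂ) * Complex.I - ((t * Z ω : ℝ) : ℂ) ^ 2 / 2)) ∂P := by
    have hi4 : Integrable (fun ω => 1 + ((t * Z ω : ℝ) : ℂ) * Complex.I -
        ((t * Z ω : ℝ) : ℂ) ^ 2 / 2) P := hi3.sub hi2'
    rw [integral_sub hie hi4, integral_sub hi3 hi2',
      integral_add (integrable_const _) hi1', e1, e2, hchar]
    simp
    ring
  rw [hsplit, ← integral_const_mul]
  refine norm_integral_le_of_norm_le (hi2.const_mul _) ?_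
  filter_upwards [hη] with ω h
  have hb : |t * Z ω| ≤ |t| * η := by rw [abs_mul]; gcongr
  refine (norm_exp_mul_I_sub_quadratic_le (hb.trans ht)).trans ?_
  calc |t * Z ω| * (t * Z ω) ^ 2 ≤ (|t| * η) * (t * Z ω) ^ 2 := by gcongr
    _ = _ := by ring

/-- **Central limit theorem** for the row sums of a triangular array whose rows are uniformly
bounded functions of the same i.i.d. sequence, with bounds tending to zero. -/
theorem tendstoNormal_row_sum {Y : ℕ → Ω → ℝ} (hY : ∀ k, AEMeasurable (Y k) P)
    (hindep : iIndepFun Y P) (hident : ∀ k, IdentDistrib (Y k) (Y 0) P P) {f : ℕ → ℝ → ℝ}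
    (hf : ∀ n, Measurable (f n)) {η : ℕ → ℝ} (hη : Tendsto η atTop (𝓝 0))
    (hbound : ∀ᶠ n in atTop, ∀ᵐ ω ∂P, |f n (Y 0 ω)| ≤ η n)
    (h0 : ∀ᶠ n in atTop, ∫ ω, f n (Y 0 ω) ∂P = 0) {v : ℝ} (hv : 0 ≤ v)
    (h2 : Tendsto (fun n : ℕ => n * ∫ ω, f n (Y 0 ω) ^ 2 ∂P) atTop (𝓝 v)) :
    TendstoNormal P (fun n ω => ∑ k ∈ Finset.range n, f n (Y k ω)) v := by
  have hfm : ∀ n k, AEMeasurable (fun ω => f n (Y k ω)) P := fun n k =>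
    (hf n).comp_aemeasurable (hY k)
  refine ⟨fun n => Finset.aemeasurable_fun_sum _ fun k _ => hfm n k, aemeasurable_id, ?_⟩
  refine ProbabilityMeasure.tendsto_iff_tendsto_charFun.2 fun t => ?_
  have hpow : ∀ n : ℕ, charFun (P.map fun ω => ∑ k ∈ Finset.range n, f n (Y k ω)) t =
      (1 + (charFun (P.map fun ω => f n (Y 0 ω)) t - 1)) ^ n := by
    intro n
    have hi : iIndepFun (fun k ω => f n (Y k ω)) P := hindep.comp (fun _ => f n) fun _ => hf n
    rw [(hi.restrict _).charFun_map_fun_finsetSum_eq_prod (fun _ _ => hfm n _)]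
    have : ∀ k, P.map (fun ω => f n (Y k ω)) = P.map (fun ω => f n (Y 0 ω)) := fun k =>
      ((hident k).comp (hf n)).map_eq
    simp [this]
  have hlim : charFun ((gaussianReal 0 v.toNNReal).map id) t = Complex.exp (-(t ^ 2 * v / 2)) := by
    rw [Measure.map_id, charFun_gaussianReal]
    congr 1
    rw [Real.coe_toNNReal v hv]
    push_cast
    ring
  simp only [ProbabilityMeasure.coe_mk]
  rw [hlim]
  simp_rw [hpow]
  -- It remains to find the limit of `n * (φ - 1)`, with `φ` the characteristic function of one
  -- summand.
  refine Complex.tendsto_one_add_pow_exp_of_tendsto ?_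
  have hmain : Tendsto (fun n : ℕ => (-((t : ℂ) ^ 2 / 2) * ((n * ∫ ω, f n (Y 0 ω) ^ 2 ∂P : ℝ) : ℂ)))
      atTop (𝓝 (-((t : ℂ) ^ 2 * v / 2))) := by
    have := ((Complex.continuous_ofReal.tendsto v).comp h2).const_mul (-((t : ℂ) ^ 2 / 2))
    convert! this using 2
    ring
  have herr : Tendsto (fun n : ℕ => (n : ℂ) * (charFun (P.map fun ω => f n (Y 0 ω)) t - 1) -
      (-(t ^ 2 / 2) * ((n * ∫ ω, f n (Y 0 ω) ^ 2 ∂P : ℝ) : ℂ))) atTop (𝓝 0) := by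
    -- Summed over the row, the remainder is `η n` times a quantity converging to a multiple of `v`.
    have hz : Tendsto (fun n : ℕ => |t| * η n * t ^ 2 * (n * ∫ ω, f n (Y 0 ω) ^ 2 ∂P)) atTop
        (𝓝 0) := by
      have := (((hη.const_mul |t|).mul_const (t ^ 2)).mul h2)
      simpa using this
    refine squeeze_zero_norm' ?_ hz
    have hsmall : ∀ᶠ n in atTop, |t| * η n ≤ 1 := by
      have := hη.const_mul |t|
      rw [mul_zero] at this
      exact this.eventually (ge_mem_nhds one_pos)
    filter_upwards [hbound, h0, hsmall] with n hb hz hs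
    have := norm_charFun_sub_quadratic_le (hfm n 0) hb hz hs
    have e : (n : ℂ) * (charFun (P.map fun ω => f n (Y 0 ω)) t - 1) -
      (-(t ^ 2 / 2) * ((n * ∫ ω, f n (Y 0 ω) ^ 2 ∂P : ℝ) : ℂ)) = n *
      (charFun (P.map fun ω => f n (Y 0 ω)) t - 1 +
        t ^ 2 / 2 * ((∫ ω, f n (Y 0 ω) ^ 2 ∂P : ℝ) : ℂ)) := by
      push_cast; ring
    rw [e, norm_mul]
    calc _ ≤ ‖(n : ℂ)‖ * (|t| * η n * t ^ 2 * ∫ ω, f n (Y 0 ω) ^ 2 ∂P) := by gcongr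
      _ = _ := by simp; ring
  simpa using herr.add hmain

end Rows

/-! ### The Pareto law and its truncated moments -/

section Pareto

lemma paretoMeasure_Ioi {a x : ℝ} (ha : 0 < a) (hx : 1 ≤ x) :
    paretoMeasure 1 a (Set.Ioi x) = ENNReal.ofReal (x ^ (-a)) := by
  have hx0 : 0 < x := by linarith
  have hint : IntegrableOn (fun y : ℝ => y ^ (-(a + 1))) (Set.Ioi x) :=
    integrableOn_Ioi_rpow_of_lt (by linarith) hx0
  rw [paretoMeasure, withDensity_apply _ measurableSet_Ioi]
  have : ∫⁻ y in Set.Ioi x, paretoPDF 1 a y =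
      ∫⁻ y in Set.Ioi x, ENNReal.ofReal (a * y ^ (-(a + 1))) := by
    refine setLIntegral_congr_fun measurableSet_Ioi fun y hy => ?_
    rw [paretoPDF_of_le (hx.trans (le_of_lt hy))]
    simp
  rw [this, ← ofReal_integral_eq_lintegral_ofReal (hint.const_mul a)]
  · rw [integral_const_mul, integral_Ioi_rpow_of_lt (by linarith) hx0]
    congr 1
    have : -(a + 1) + 1 = -a := by ring
    rw [this]
    field_simp
  · refine (ae_restrict_iff' measurableSet_Ioi).2 (ae_of_all _ fun y hy => ?_)
    have : 0 < y := hx0.trans hy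
    simp only [Pi.zero_apply]
    positivity

lemma paretoMeasure_real_Iic {a x : ℝ} (ha : 0 < a) (hx : 1 ≤ x) :
    (paretoMeasure 1 a).real (Set.Iic x) = 1 - 1 / x ^ a := by
  have := isProbabilityMeasure_paretoMeasure one_pos ha
  have h := probReal_compl_eq_one_sub (μ := paretoMeasure 1 a) (measurableSet_Ioi (a := x))
  rw [Set.compl_Ioi, measureReal_def, measureReal_def, paretoMeasure_Ioi ha hx,
    ENNReal.toReal_ofReal (by positivity)] at h
  rw [measureReal_def, h, Real.rpow_neg (by linarith), one_div]

/-- The hypothesis at `x = 1` leaves no mass on `(-∞, 1]`, which fixes the distribution function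
below `1` as well. -/
lemma map_eq_paretoMeasure {Ω : Type*} [MeasurableSpace Ω] {P : Measure Ω}
    [IsProbabilityMeasure P] {Y : Ω → ℝ} (hY : Measurable Y) {a : ℝ} (ha : 0 < a)
    (hdist : ∀ x : ℝ, 1 ≤ x → P.real {ω | Y ω ≤ x} = 1 - 1 / x ^ a) :
    P.map Y = paretoMeasure 1 a := by
  have := isProbabilityMeasure_paretoMeasure one_pos ha
  have := Measure.isProbabilityMeasure_map (μ := P) hY.aemeasurable
  have h1 : ∀ x : ℝ, 1 ≤ x → P.map Y (Set.Iic x) = paretoMeasure 1 a (Set.Iic x) := by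
    intro x hx
    have h2 : (P.map Y).real (Set.Iic x) = (paretoMeasure 1 a).real (Set.Iic x) := by
      rw [paretoMeasure_real_Iic ha hx, map_measureReal_apply hY measurableSet_Iic]
      exact hdist x hx
    exact (measureReal_eq_measureReal_iff).1 h2
  refine Measure.ext_of_Iic _ _ fun x => ?_
  rcases le_or_gt 1 x with hx | hx
  · exact h1 x hx
  · have h3 : paretoMeasure 1 a (Set.Iic 1) = 0 := by
      have := paretoMeasure_real_Iic ha le_rfl
      simpa [measureReal_eq_zero_iff] using this
    rw [measure_mono_null (Set.Iic_subset_Iic.2 hx.le) h3,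
      measure_mono_null (Set.Iic_subset_Iic.2 hx.le) ((h1 1 le_rfl).trans h3)]

lemma ae_one_lt_paretoMeasure {a : ℝ} (ha : 0 < a) : ∀ᵐ y ∂(paretoMeasure 1 a), 1 < y := by
  have := isProbabilityMeasure_paretoMeasure one_pos ha
  have h3 : paretoMeasure 1 a (Set.Iic 1) = 0 := by
    have := paretoMeasure_real_Iic ha le_rfl
    simpa [measureReal_eq_zero_iff] using this
  rw [ae_iff]
  refine measure_mono_null (fun y hy => ?_) h3
  exact not_lt.1 hy

/-- The condition `p ≠ 0` makes the integrand vanish above `c`, where `trunc` is `0`. -/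
lemma integral_trunc_pow_paretoMeasure {a c : ℝ} (ha : 0 < a) (hc : 1 ≤ c) {p : ℕ} (hp : p ≠ 0) :
    ∫ y, trunc c y ^ p ∂(paretoMeasure 1 a) = a * ∫ y in (1 : ℝ)..c, y ^ ((p : ℝ) - a - 1) := by
  have hm : Measurable (paretoPDF 1 a) := (measurable_paretoPDFReal 1 a).ennreal_ofReal
  rw [paretoMeasure, integral_withDensity_eq_integral_toReal_smul hm
    (ae_of_all _ fun y => ENNReal.ofReal_lt_top)]
  rw [← intervalIntegral.integral_const_mul, intervalIntegral.integral_of_le hc,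
    ← integral_Icc_eq_integral_Ioc, ← integral_indicator measurableSet_Icc]
  refine integral_congr_ae (ae_of_all _ fun y => ?_)
  simp only [smul_eq_mul]
  rw [paretoPDF, ENNReal.toReal_ofReal (paretoPDFReal_nonneg zero_le_one ha.le y)]
  by_cases h1 : 1 ≤ y
  · by_cases h2 : y ≤ c
    · rw [Set.indicator_of_mem (Set.mem_Icc.2 ⟨h1, h2⟩), paretoPDFReal, if_pos h1, trunc, if_pos h2,
        Real.one_rpow, mul_one, mul_assoc]
      have hy : 0 < y := by linarith
      rw [← Real.rpow_natCast y p, ← Real.rpow_add hy]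
      congr 2; ring
    · rw [Set.indicator_of_notMem (fun h => h2 h.2), trunc, if_neg h2, zero_pow hp, mul_zero]
  · rw [Set.indicator_of_notMem (fun h => h1 h.1), paretoPDFReal, if_neg h1, zero_mul]

lemma integral_trunc_paretoMeasure {a c : ℝ} (ha : 0 < a) (ha1 : a < 1) (hc : 1 ≤ c) :
    ∫ y, trunc c y ∂(paretoMeasure 1 a) = paretoTruncMean c a := by
  have h := integral_trunc_pow_paretoMeasure ha hc one_ne_zero
  simp only [pow_one, Nat.cast_one] at h
  rw [h, integral_rpow (Or.inl (by linarith))]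
  have : 1 - a - 1 + 1 = 1 - a := by ring
  rw [this, Real.one_rpow, paretoTruncMean]
  ring

lemma integral_trunc_paretoMeasure_one {c : ℝ} (hc : 1 ≤ c) :
    ∫ y, trunc c y ∂(paretoMeasure 1 1) = Real.log c := by
  have h := integral_trunc_pow_paretoMeasure one_pos hc one_ne_zero
  simp only [pow_one, Nat.cast_one] at h
  rw [h, one_mul]
  have : ∫ y in (1 : ℝ)..c, y ^ ((1 : ℝ) - 1 - 1) = ∫ y in (1 : ℝ)..c, y⁻¹ := by
    congr 1; ext y
    rw [show (1 : ℝ) - 1 - 1 = -1 by norm_num, Real.rpow_neg_one]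
  rw [this, integral_inv_of_pos one_pos (by linarith), div_one]

lemma integral_trunc_sq_paretoMeasure {a c : ℝ} (ha : 0 < a) (ha1 : a < 2) (hc : 1 ≤ c) :
    ∫ y, trunc c y ^ 2 ∂(paretoMeasure 1 a) = a / (2 - a) * (c ^ (2 - a) - 1) := by
  have h := integral_trunc_pow_paretoMeasure ha hc two_ne_zero
  simp only [Nat.cast_ofNat] at h
  rw [h, integral_rpow (Or.inl (by linarith))]
  have : 2 - a - 1 + 1 = 2 - a := by ring
  rw [this, Real.one_rpow]
  ring

end Pareto

/-! ### Tails and normal limits of truncated sample means -/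

section Sample

variable {Ω : Type*} [MeasurableSpace Ω] {P : Measure Ω}
  {Y : ℕ → Ω → ℝ} {a : ℝ}

lemma ae_one_lt_of_map_eq {Y : Ω → ℝ} (hY : Measurable Y) (ha : 0 < a)
    (hlaw : P.map Y = paretoMeasure 1 a) : ∀ᵐ ω ∂P, 1 < Y ω := by
  have := ae_one_lt_paretoMeasure ha
  rw [← hlaw] at this
  exact ae_of_ae_map hY.aemeasurable this

lemma integral_comp_of_map_eq {Y : Ω → ℝ} (hY : Measurable Y)
    (hlaw : P.map Y = paretoMeasure 1 a) {g : ℝ → ℝ} (hg : Measurable g) :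
    ∫ ω, g (Y ω) ∂P = ∫ y, g y ∂(paretoMeasure 1 a) := by
  rw [← hlaw, integral_map hY.aemeasurable hg.aestronglyMeasurable]

lemma identDistrib_of_map_eq (hY : ∀ k, Measurable (Y k))
    (hlaw : ∀ k, P.map (Y k) = paretoMeasure 1 a) (k : ℕ) : IdentDistrib (Y k) (Y 0) P P :=
  ⟨(hY k).aemeasurable, (hY 0).aemeasurable, by rw [hlaw, hlaw]⟩

lemma measurable_truncMean (hY : ∀ k, Measurable (Y k)) (b : ℕ → ℝ) (n : ℕ) :
    Measurable (truncMean Y b n) :=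
  (Finset.measurable_fun_sum _ fun k _ => (measurable_trunc _).comp (hY k)).const_mul _

lemma ae_truncMean_nonneg (hY : ∀ k, Measurable (Y k)) (ha : 0 < a)
    (hlaw : ∀ k, P.map (Y k) = paretoMeasure 1 a) (b : ℕ → ℝ) (n : ℕ) :
    ∀ᵐ ω ∂P, 0 ≤ truncMean Y b n ω := by
  filter_upwards [ae_all_iff.2 fun k => ae_one_lt_of_map_eq (hY k) ha (hlaw k)] with ω h
  exact mul_nonneg (by positivity)
    (Finset.sum_nonneg fun k _ => trunc_nonneg (by linarith [h k]))

lemma exp_neg_le_inv_sq {n : ℕ} (hn : 0 < n) {x : ℝ} (hx : 2 * Real.log n ≤ x) :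
    Real.exp (-x) ≤ 1 / (n : ℝ) ^ 2 := by
  have hn' : (0 : ℝ) < n := by exact_mod_cast hn
  calc Real.exp (-x) ≤ Real.exp (-(2 * Real.log n)) := by gcongr
    _ = _ := by
      rw [Real.exp_neg, two_mul, Real.exp_add, Real.exp_log hn', one_div, sq]

lemma ae_trunc_mem (hY : ∀ k, Measurable (Y k)) (ha : 0 < a)
    (hlaw : ∀ k, P.map (Y k) = paretoMeasure 1 a) {c : ℝ} (hc : 0 < c) (k : ℕ) :
    ∀ᵐ ω ∂P, 0 ≤ trunc c (Y k ω) ∧ trunc c (Y k ω) ≤ c := by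
  filter_upwards [ae_one_lt_of_map_eq (hY k) ha (hlaw k)] with ω h
  exact ⟨trunc_nonneg (by linarith), trunc_le hc.le⟩

variable [IsProbabilityMeasure P]

/-- The lower tail is weakened to the exponent of the upper one, so that a single estimate serves
both. -/
lemma truncMean_tail (hY : ∀ k, Measurable (Y k)) (hindep : iIndepFun Y P) (ha : 0 < a)
    (hlaw : ∀ k, P.map (Y k) = paretoMeasure 1 a) {b : ℕ → ℝ} {n : ℕ} (hn : 0 < n)
    (hb : 0 < b n) {V t : ℝ} (hV₀ : 0 < V)
    (hV : ∫ y, trunc (b n) y ^ 2 ∂(paretoMeasure 1 a) ≤ V) (ht : 0 < t) :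
    P.real {ω | (∫ y, trunc (b n) y ∂(paretoMeasure 1 a)) + t ≤ truncMean Y b n ω} ≤
        Real.exp (-(n * (t ^ 2 / (2 * (V + b n * t / 3))))) ∧
      P.real {ω | truncMean Y b n ω ≤ (∫ y, trunc (b n) y ∂(paretoMeasure 1 a)) - t} ≤
        Real.exp (-(n * (t ^ 2 / (2 * (V + b n * t / 3))))) := by
  have hn' : (0 : ℝ) < n := by exact_mod_cast hn
  have hZ : ∀ k, AEMeasurable (fun ω => trunc (b n) (Y k ω)) P := fun k =>
    ((measurable_trunc _).comp (hY k)).aemeasurable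
  have hi : iIndepFun (fun k ω => trunc (b n) (Y k ω)) P :=
    hindep.comp (fun _ => trunc (b n)) fun _ => measurable_trunc _
  have hid : ∀ k, IdentDistrib (fun ω => trunc (b n) (Y k ω)) (fun ω => trunc (b n) (Y 0 ω)) P P :=
    fun k => (identDistrib_of_map_eq hY hlaw k).comp (measurable_trunc _)
  have hmem := ae_trunc_mem hY ha hlaw hb
  have hV' : ∫ ω, trunc (b n) (Y 0 ω) ^ 2 ∂P ≤ V := by
    rw [integral_comp_of_map_eq (hY 0) (hlaw 0) (g := fun y => trunc (b n) y ^ 2)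
      ((measurable_trunc _).pow_const 2)]
    exact hV
  have hmean := integral_comp_of_map_eq (hY 0) (hlaw 0) (measurable_trunc (b n))
  have h1 := measure_sum_ge_le_bernstein hZ hi hid hb hmem hV' hV₀ ht n
  have h2 := measure_sum_le_le_bernstein hZ hi hid hmem hV' hV₀ ht n
  rw [hmean] at h1 h2
  constructor
  · refine le_trans (le_of_eq ?_) h1
    congr 1; ext ω
    simp only [Set.mem_ofPred_eq, truncMean]
    rw [inv_mul_eq_div, le_div_iff₀' hn']
  · refine (le_trans (le_of_eq ?_) h2).trans ?_
    · congr 1; ext ω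
      simp only [Set.mem_ofPred_eq, truncMean]
      rw [inv_mul_eq_div, div_le_iff₀' hn']
    · have : 0 ≤ b n * t / 3 := by positivity
      gcongr
      linarith

/-- The **central limit theorem** for truncated means of a Pareto sample. -/
lemma tendstoNormal_truncMean (hY : ∀ k, Measurable (Y k)) (hindep : iIndepFun Y P) (ha : 0 < a)
    (hlaw : ∀ k, P.map (Y k) = paretoMeasure 1 a) {b s : ℕ → ℝ} (hb : ∀ n, 0 < b n)
    (hs : ∀ᶠ n in atTop, 0 < s n)
    (hbs : Tendsto (fun n : ℕ => b n / (√(n : ℝ) * s n)) atTop (𝓝 0)) {v : ℝ}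
    (hv : Tendsto (fun n => (∫ y, trunc (b n) y ^ 2 ∂(paretoMeasure 1 a) -
      (∫ y, trunc (b n) y ∂(paretoMeasure 1 a)) ^ 2) / s n ^ 2) atTop (𝓝 v)) (κ : ℝ) (hv₀ : 0 ≤ v) :
    TendstoNormal P (fun n ω => κ * (√(n : ℝ) *
      (truncMean Y b n ω - ∫ y, trunc (b n) y ∂(paretoMeasure 1 a)) / s n)) (κ ^ 2 * v) := by
  set μ : ℕ → ℝ := fun n => ∫ y, trunc (b n) y ∂(paretoMeasure 1 a) with hμ
  -- The factor `κ` carries the slope of the later linearization into the limit theorem.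
  set f : ℕ → ℝ → ℝ := fun n y => κ / (√(n : ℝ) * s n) * (trunc (b n) y - μ n) with hf
  have hfm : ∀ n, Measurable (f n) := fun n => ((measurable_trunc _).sub_const _).const_mul _
  have hsum : (fun (n : ℕ) ω => ∑ k ∈ Finset.range n, f n (Y k ω)) =
      fun (n : ℕ) ω => κ * (√(n : ℝ) * (truncMean Y b n ω - μ n) / s n) := by
    funext n ω
    simp only [hf]
    rw [← Finset.mul_sum, Finset.sum_sub_distrib, truncMean]
    rcases Nat.eq_zero_or_pos n with rfl | hn
    · simp
    · have hn' : (0 : ℝ) < n := by exact_mod_cast hn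
      have hq : √(n : ℝ) ≠ 0 := (Real.sqrt_pos.2 hn').ne'
      simp only [Finset.sum_const, Finset.card_range, nsmul_eq_mul]
      have hq2 : (n : ℝ) = √(n : ℝ) * √(n : ℝ) := (Real.mul_self_sqrt hn'.le).symm
      set q := √(n : ℝ)
      rw [hq2]
      by_cases hsn : s n = 0
      · simp [hsn]
      · field_simp
  have := isProbabilityMeasure_paretoMeasure one_pos ha
  have hmem : ∀ n, ∀ᵐ y ∂(paretoMeasure 1 a), 0 ≤ trunc (b n) y ∧ trunc (b n) y ≤ b n := by
    intro n
    filter_upwards [ae_one_lt_paretoMeasure ha] with y hy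
    exact ⟨trunc_nonneg (by linarith), trunc_le (hb n).le⟩
  have hi1 : ∀ n, Integrable (trunc (b n)) (paretoMeasure 1 a) := fun n =>
    integrable_of_ae_mem (measurable_trunc _).aemeasurable (M := b n) <| by
      filter_upwards [hmem n] with y hy
      rw [abs_of_nonneg hy.1]; exact hy.2
  have hi2 : ∀ n, Integrable (fun y => trunc (b n) y ^ 2) (paretoMeasure 1 a) := fun n =>
    integrable_of_ae_mem ((measurable_trunc _).pow_const 2).aemeasurable (M := b n ^ 2) <| by
      filter_upwards [hmem n] with y hy
      rw [abs_of_nonneg (by positivity)]; exact pow_le_pow_left₀ hy.1 hy.2 2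
  have hμ0 : ∀ n, 0 ≤ μ n := fun n => integral_nonneg_of_ae <| by
    filter_upwards [hmem n] with y hy using hy.1
  have hμb : ∀ n, μ n ≤ b n := fun n => by
    have : ∫ y, trunc (b n) y ∂(paretoMeasure 1 a) ≤ ∫ _, b n ∂(paretoMeasure 1 a) :=
      integral_mono_ae (hi1 n) (integrable_const _) (by
        filter_upwards [hmem n] with y hy using hy.2)
    simpa using this
  rw [← hsum]
  refine tendstoNormal_row_sum (fun k => (hY k).aemeasurable) hindep
    (identDistrib_of_map_eq hY hlaw) hfm (η := fun n => |κ| * (b n / (√(n : ℝ) * s n)))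
    -- The truncated variable and its mean both lie in `[0, b n]`, so their difference is at most `b
    -- n` in absolute value.
    (by simpa using hbs.const_mul |κ|) ?_ ?_ (by positivity) ?_
  · filter_upwards [hs] with n hsn
    filter_upwards [ae_trunc_mem hY ha hlaw (hb n) 0] with ω h
    simp only [hf]
    rw [abs_mul, abs_div, abs_of_nonneg (by positivity : 0 ≤ √(n : ℝ) * s n), mul_div_assoc']
    rw [div_mul_eq_mul_div]
    gcongr
    rw [abs_le]
    exact ⟨by linarith [h.1, hμb n], by linarith [h.2, hμ0 n]⟩
  · refine Eventually.of_forall fun n => ?_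
    rw [integral_comp_of_map_eq (hY 0) (hlaw 0) (hfm n)]
    simp only [hf]
    rw [integral_const_mul, integral_sub (hi1 n) (integrable_const _)]
    simp [hμ]
  · refine ((hv.const_mul (κ ^ 2)).congr' ?_)
    filter_upwards [hs, eventually_gt_atTop 0] with n hsn hn
    have hn' : (0 : ℝ) < n := by exact_mod_cast hn
    rw [integral_comp_of_map_eq (hY 0) (hlaw 0) (g := fun y => f n y ^ 2) ((hfm n).pow_const 2)]
    have e : ∀ y, f n y ^ 2 = (κ / (√(n : ℝ) * s n)) ^ 2 *
        (trunc (b n) y ^ 2 - (2 * μ n * trunc (b n) y - μ n ^ 2)) := by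
      intro y; simp only [hf]; ring
    simp_rw [e]
    have hi3 : Integrable (fun y => 2 * μ n * trunc (b n) y) (paretoMeasure 1 a) :=
      (hi1 n).const_mul _
    have hi4 : Integrable (fun y => 2 * μ n * trunc (b n) y - μ n ^ 2) (paretoMeasure 1 a) :=
      hi3.sub (integrable_const _)
    rw [integral_const_mul, integral_sub (hi2 n) hi4, integral_sub hi3 (integrable_const _),
      integral_const_mul]
    simp only [integral_const, probReal_univ, smul_eq_mul, one_mul]
    rw [div_pow, mul_pow, Real.sq_sqrt hn'.le]
    change _ = (n : ℝ) * (κ ^ 2 / (n * s n ^ 2) *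
      (∫ y, trunc (b n) y ^ 2 ∂(paretoMeasure 1 a) - (2 * μ n * μ n - μ n ^ 2)))
    field_simp
    ring

end Sample

/-! ### Index one, and concentration of the largest root -/

section Sample

variable {Ω : Type*} [MeasurableSpace Ω] {P : Measure Ω} [IsProbabilityMeasure P]
  {Y : ℕ → Ω → ℝ} {a : ℝ}

/-- Needed because the moment formulas hold only once `b n ≥ 1`. -/
lemma TendstoNormal.congr_eventually {Z Z' : ℕ → Ω → ℝ} {v : ℝ} (h : TendstoNormal P Z v)
    (hZ' : ∀ n, AEMeasurable (Z' n) P) (hZZ' : ∀ᶠ n in atTop, Z n =ᵐ[P] Z' n) :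
    TendstoNormal P Z' v := by
  refine ⟨hZ', h.aemeasurable_limit, h.tendsto.congr' ?_⟩
  filter_upwards [hZZ'] with n hn
  exact Subtype.ext (Measure.map_congr hn)

lemma measureReal_le_of_subset_tails {S : Set Ω} {m : Ω → ℝ} {μ t p : ℝ}
    (hS : S ⊆ {ω | μ + t ≤ m ω} ∪ {ω | m ω ≤ μ - t})
    (h1 : P.real {ω | μ + t ≤ m ω} ≤ p) (h2 : P.real {ω | m ω ≤ μ - t} ≤ p) :
    P.real S ≤ 2 * p :=
  calc P.real S ≤ P.real ({ω | μ + t ≤ m ω} ∪ {ω | m ω ≤ μ - t}) := measureReal_mono hS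
    _ ≤ P.real {ω | μ + t ≤ m ω} + P.real {ω | m ω ≤ μ - t} := measureReal_union_le _ _
    _ ≤ 2 * p := by linarith

/-- The second moment is at most `b n`, and `t = 2 * √2 / n ^ β ≤ 3` bounds the Bernstein
denominator by `4 * b n`. As `n * t ^ 2 = 8 * n ^ (1 - 2 * β)`, the exponent is at least `2 * log
n`; this is where `2 * √2` comes from. -/
lemma truncMean_div_log_concentration (hY : ∀ k, Measurable (Y k)) (hindep : iIndepFun Y P)
    (hlaw : ∀ k, P.map (Y k) = paretoMeasure 1 1) {b : ℕ → ℝ} (hb : Tendsto b atTop atTop)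
    {β : ℝ} (hβ : 0 ≤ β)
    (hcond : ∀ᶠ n : ℕ in atTop, b n ≤ (n : ℝ) ^ (1 - 2 * β) / Real.log n) :
    ∀ᶠ n : ℕ in atTop, P.real {ω | 2 * √2 / ((n : ℝ) ^ β * Real.log (b n)) ≤
      |truncMean Y b n ω / Real.log (b n) - 1|} ≤ 2 / (n : ℝ) ^ 2 := by
  filter_upwards [hcond, hb.eventually_gt_atTop 1, eventually_gt_atTop 1] with n hc hb1 hn
  have hn1 : (1 : ℝ) < n := by exact_mod_cast hn
  have hn0 : (0 : ℝ) < n := by linarith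
  have hln : 0 < Real.log n := Real.log_pos hn1
  have hL : 0 < Real.log (b n) := Real.log_pos hb1
  have hb0 : 0 < b n := by linarith
  have hnβ : 1 ≤ (n : ℝ) ^ β := Real.one_le_rpow hn1.le hβ
  have hnβ0 : 0 < (n : ℝ) ^ β := by linarith
  set t := 2 * √2 / (n : ℝ) ^ β with ht
  have h2 : √2 ^ 2 = (2 : ℝ) := Real.sq_sqrt (by norm_num)
  have ht0 : 0 < t := by positivity
  have ht3 : t ≤ 3 := by
    have h3 : 2 * √2 ≤ 3 := by nlinarith [Real.sqrt_nonneg 2]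
    calc t ≤ 2 * √2 := div_le_self (by positivity) hnβ
      _ ≤ 3 := h3
  have ht2 : n * t ^ 2 = 8 * (n : ℝ) ^ (1 - 2 * β) := by
    rw [ht, div_pow, mul_pow, h2, Real.rpow_sub hn0, Real.rpow_one, mul_comm 2 β,
      Real.rpow_mul hn0.le, Real.rpow_two]
    ring
  have hV : ∫ y, trunc (b n) y ^ 2 ∂(paretoMeasure 1 1) ≤ b n := by
    rw [integral_trunc_sq_paretoMeasure one_pos one_lt_two hb1.le]
    norm_num
  obtain ⟨hu, hl⟩ := truncMean_tail hY hindep one_pos hlaw (by omega) hb0 hb0 hV ht0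
  rw [integral_trunc_paretoMeasure_one hb1.le] at hu hl
  have hexp : Real.exp (-(n * (t ^ 2 / (2 * (b n + b n * t / 3))))) ≤ 1 / (n : ℝ) ^ 2 := by
    refine exp_neg_le_inv_sq (by omega) ?_
    rw [le_div_iff₀ hln] at hc
    rw [← mul_div_assoc, ht2, le_div_iff₀ (by positivity)]
    have : b n * t ≤ b n * 3 := by gcongr
    calc 2 * Real.log n * (2 * (b n + b n * t / 3))
        ≤ 2 * Real.log n * (2 * (b n + b n * 3 / 3)) := by gcongr
      _ = 8 * (b n * Real.log n) := by ring
      _ ≤ _ := by gcongr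
  have := measureReal_le_of_subset_tails (S := {ω | 2 * √2 / ((n : ℝ) ^ β * Real.log (b n)) ≤
      |truncMean Y b n ω / Real.log (b n) - 1|}) ?_ (hu.trans hexp) (hl.trans hexp)
  · rwa [mul_one_div] at this
  · intro ω hω
    simp only [Set.mem_ofPred_eq, Set.mem_union] at hω ⊢
    have e : truncMean Y b n ω / Real.log (b n) - 1 =
        (truncMean Y b n ω - Real.log (b n)) / Real.log (b n) := by field_simp
    rw [e, abs_div, abs_of_pos hL, ← div_div, div_le_div_iff_of_pos_right hL, le_abs] at hω
    rcases hω with h | h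
    · left; linarith
    · right; linarith

/-- The variance is `b n - 1 - log (b n) ^ 2`, so `√(b n)` is the right scale. -/
lemma tendstoNormal_truncMean_div_log (hY : ∀ k, Measurable (Y k)) (hindep : iIndepFun Y P)
    (hlaw : ∀ k, P.map (Y k) = paretoMeasure 1 1) {b : ℕ → ℝ} (hb₀ : ∀ n, 0 < b n)
    (hb : Tendsto b atTop atTop) (hbn : Tendsto (fun n : ℕ => b n / n) atTop (𝓝 0)) :
    TendstoNormal P (fun n ω => √(n : ℝ) * (truncMean Y b n ω / Real.log (b n) - 1) *
      Real.log (b n) / √(b n)) 1 := by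
  have h := tendstoNormal_truncMean hY hindep one_pos hlaw hb₀ (s := fun n => √(b n))
    (Eventually.of_forall fun n => Real.sqrt_pos.2 (hb₀ n)) ?_ (v := 1) ?_ 1 zero_le_one
  · rw [one_pow, one_mul] at h
    refine h.congr_eventually (fun n => ?_) ?_
    · have := measurable_truncMean hY b n
      fun_prop
    · filter_upwards [hb.eventually_gt_atTop 1] with n hn
      refine ae_of_all _ fun ω => ?_
      have hL : Real.log (b n) ≠ 0 := (Real.log_pos hn).ne'
      simp only []
      rw [integral_trunc_paretoMeasure_one hn.le]
      field_simp
  · have := (Real.continuous_sqrt.tendsto 0).comp hbn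
    rw [Real.sqrt_zero] at this
    refine this.congr fun n => ?_
    simp only [Function.comp]
    rw [Real.sqrt_div (hb₀ n).le, ← div_div, div_right_comm, Real.div_sqrt]
  · have h1 : Tendsto (fun x : ℝ => 1 - x⁻¹ - Real.log x ^ 2 / x) atTop (𝓝 (1 - 0 - 0)) := by
      refine (tendsto_const_nhds.sub tendsto_inv_atTop_zero).sub ?_
      have := Real.isLittleO_pow_log_id_atTop (n := 2)
      exact this.tendsto_div_nhds_zero
    rw [sub_zero, sub_zero] at h1
    refine (h1.comp hb).congr' ?_
    filter_upwards [hb.eventually_gt_atTop 1] with n hn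
    rw [integral_trunc_paretoMeasure_one hn.le,
      integral_trunc_sq_paretoMeasure one_pos one_lt_two hn.le, Real.sq_sqrt (hb₀ n).le]
    have := (hb₀ n).ne'
    simp only [Function.comp]
    norm_num
    field_simp

omit [IsProbabilityMeasure P] in
lemma aemeasurable_largestRoot_truncMean (hY : ∀ k, Measurable (Y k)) (ha : 0 < a)
    (hlaw : ∀ k, P.map (Y k) = paretoMeasure 1 a) {b : ℕ → ℝ} (hb₀ : ∀ n, 0 < b n) {l : ℝ}
    (hl : 0 ≤ l) (n : ℕ) : AEMeasurable (fun ω => largestRoot l (b n) (truncMean Y b n ω)) P := by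
  refine ((measurable_largestRoot_max hl (hb₀ n)).comp
    (measurable_truncMean hY b n)).aemeasurable.congr ?_
  filter_upwards [ae_truncMean_nonneg hY ha hlaw b n] with ω h
  simp only [Function.comp, max_eq_left h]

lemma tendsto_rpow_neg_comp {b : ℕ → ℝ} (hb : Tendsto b atTop atTop) {y : ℝ} (hy : 0 < y) :
    Tendsto (fun n => b n ^ (-y)) atTop (𝓝 0) :=
  (tendsto_rpow_neg_atTop hy).comp hb

lemma tendsto_paretoTruncMean_div {b : ℕ → ℝ} (hb : Tendsto b atTop atTop) (ha1 : a < 1) :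
    Tendsto (fun n => paretoTruncMean (b n) a / b n ^ (1 - a)) atTop (𝓝 (a / (1 - a))) := by
  have h := ((tendsto_rpow_neg_comp hb (sub_pos.2 ha1)).const_sub 1).const_mul (a / (1 - a))
  rw [sub_zero, mul_one] at h
  refine h.congr' ?_
  filter_upwards [hb.eventually_gt_atTop 0] with n hn
  rw [paretoTruncMean, Real.rpow_neg hn.le]
  have : 0 < b n ^ (1 - a) := Real.rpow_pos_of_pos hn _
  field_simp

/-- Concentration of the largest root around the true tail index. -/
lemma largestRoot_concentration (hY : ∀ k, Measurable (Y k)) (hindep : iIndepFun Y P) (ha1 : a < 1)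
    (hlaw : ∀ k, P.map (Y k) = paretoMeasure 1 a) {b : ℕ → ℝ} (hb : Tendsto b atTop atTop)
    {β : ℝ} (hβ : 0 ≤ β) {l : ℝ} (hl : 0 ≤ l) (hla : l < a) {A D : ℝ} (hA : 0 < A) (hD : 0 < D)
    (hAD : 4 * A * (1 - a) ^ 2 < D ^ 2 * (2 - a))
    (hcond : ∀ᶠ n : ℕ in atTop,
      b n ^ a * Real.log (b n) ≤ A * a * (n : ℝ) ^ (1 - 2 * β) / Real.log n) :
    ∀ᶠ n : ℕ in atTop, P.real {ω | D / ((n : ℝ) ^ β * Real.log (b n) * √(Real.log (b n))) ≤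
      |largestRoot l (b n) (truncMean Y b n ω) - a|} ≤ 2 / (n : ℝ) ^ 2 := by
  have ha : 0 < a := by linarith
  have ha1' := sub_pos.2 ha1
  have ha2 : 0 < 2 - a := by linarith
  obtain ⟨p, hlp, hpa⟩ := exists_between hla
  obtain ⟨q, haq, hq⟩ := exists_between ha1
  obtain ⟨r, har, hrq⟩ := exists_between haq
  have hp : 0 < p := by linarith
  set κ := a / (1 - a) with hκ
  have hκ0 : 0 < κ := by positivity
  set R := κ ^ 2 * D ^ 2 / (A * a) with hR
  have hR0 : 0 < R := by positivity
  -- In the limit the Bernstein exponent suffices when `4 * (a / (2 - a)) ≤ R`. By `hAD` this holds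
  -- strictly; the factor `σ = θ ^ 2` spends the slack on the error `C / L n`, the quadratic term of
  -- the exponential and the term `b n * t / 3`.
  have hlt : 4 * (a / (2 - a)) / R < 1 := by
    rw [div_lt_one hR0, hR, hκ, mul_div_assoc', div_lt_div_iff₀ ha2 (by positivity), div_pow,
      div_mul_eq_mul_div, div_mul_eq_mul_div, lt_div_iff₀ (by positivity)]
    have : 0 < a ^ 2 := by positivity
    nlinarith
  obtain ⟨σ, hσ, hσ1⟩ := exists_between hlt
  have hσ0 : 0 < σ := lt_of_le_of_lt (by positivity) hσ
  rw [div_lt_iff₀ hR0] at hσ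
  set θ := √σ with hθ
  have hθ0 : 0 < θ := Real.sqrt_pos.2 hσ0
  have hθ1 : θ < 1 := by rw [hθ, Real.sqrt_lt' one_pos]; simpa using hσ1
  have hθ2 : θ ^ 2 = σ := Real.sq_sqrt hσ0.le
  set C := 1 / (p * (1 - q)) with hC
  set L : ℕ → ℝ := fun n => Real.log (b n) with hLdef
  have hL : Tendsto L atTop atTop := Real.tendsto_log_atTop.comp hb
  -- The radius in the claim is `e n / L n`; `e n` is the relative change of the mean it corresponds
  -- to.
  set e : ℕ → ℝ := fun n => D / ((n : ℝ) ^ β * √(L n)) with he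
  have he0 : Tendsto e atTop (𝓝 0) := by
    have h1 : Tendsto (fun n => D / √(L n)) atTop (𝓝 0) :=
      tendsto_const_nhds.div_atTop (Real.tendsto_sqrt_atTop.comp hL)
    refine squeeze_zero' ?_ ?_ h1
    · exact Eventually.of_forall fun n => by simp only [he]; positivity
    · filter_upwards [eventually_gt_atTop 0, hL.eventually_gt_atTop 0] with n hn hLn
      have : 1 ≤ (n : ℝ) ^ β := Real.one_le_rpow (by exact_mod_cast hn) hβ
      have h3 : 0 < √(L n) := Real.sqrt_pos.2 hLn
      simp only [he]
      refine div_le_div_of_nonneg_left hD.le h3 ?_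
      nlinarith
  have hCL : Tendsto (fun n => 1 - C / L n) atTop (𝓝 1) := by
    simpa using (tendsto_const_nhds (x := C)).div_atTop hL |>.const_sub 1
  have hfac : Tendsto (fun n => paretoTruncMean (b n) a / b n ^ (1 - a) * (1 - C / L n) *
      (1 - e n * (1 - C / L n) / 2)) atTop (𝓝 κ) := by
    have := ((tendsto_paretoTruncMean_div hb ha1).mul hCL).mul
      (((he0.mul hCL).div_const 2).const_sub 1)
    simpa using this
  have hδ0 : Tendsto (fun n => e n / L n) atTop (𝓝 0) := he0.div_atTop hL
  have hslack : Tendsto (fun n => 4 * (a / (2 - a) + θ * κ * e n / 3)) atTop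
      (𝓝 (4 * (a / (2 - a)))) := by
    have := ((((he0.const_mul (θ * κ)).div_const 3).const_add (a / (2 - a))).const_mul 4)
    simpa using this
  filter_upwards [hcond, hb.eventually_gt_atTop 1, eventually_gt_atTop 1,
    hL.eventually_gt_atTop (max C 0), hb.eventually (eventually_largestRoot_mem hl hlp
      (hpa.trans har).le hrq hq),
    hfac.eventually (lt_mem_nhds (show θ * κ < κ by nlinarith)),
    hδ0.eventually (gt_mem_nhds (sub_pos.2 hpa)), hδ0.eventually (gt_mem_nhds (sub_pos.2 har)),
    hslack.eventually (gt_mem_nhds hσ)] with n hc hb1 hn hLn hroot hf hδ1 hδ2 hs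
  have hn1 : (1 : ℝ) < n := by exact_mod_cast hn
  have hn0 : (0 : ℝ) < n := by linarith
  have hln : 0 < Real.log n := Real.log_pos hn1
  have hb0 : 0 < b n := by linarith
  obtain ⟨hLC, hL0⟩ := max_lt_iff.1 hLn
  have hnβ0 : 0 < (n : ℝ) ^ β := by positivity
  have hsq : 0 < √(L n) := Real.sqrt_pos.2 hL0
  have hen : 0 < e n := by simp only [he]; positivity
  set c := b n with hcdef
  set δ := e n / L n with hδ
  have hδpos : 0 < δ := by positivity
  have hδeq : D / ((n : ℝ) ^ β * Real.log c * √(Real.log c)) = δ := by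
    simp only [hδ, he, hLdef]
    rw [div_div]; congr 1; ring
  set x := e n * (1 - C / L n) with hx
  have hxeq : x = δ * (L n - C) := by simp only [hx, hδ]; field_simp
  have hx0 : 0 < x := by rw [hxeq]; exact mul_pos hδpos (by linarith)
  set μ := paretoTruncMean c a with hμ
  have hμ0 : 0 < μ := paretoTruncMean_pos hb1 ha ha1
  have hca : 0 < c ^ (1 - a) := Real.rpow_pos_of_pos hb0 _
  -- As `μ` is about `κ * c ^ (1 - a)`, this is the fraction `θ` of the change of the mean when the
  -- index moves by `δ`.
  set t := θ * κ * e n * c ^ (1 - a) with ht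
  have ht0 : 0 < t := by positivity
  have htle : t ≤ μ * (x - x ^ 2 / 2) := by
    have : t ≤ μ / c ^ (1 - a) * (1 - C / L n) * (1 - x / 2) * (e n * c ^ (1 - a)) := by
      calc t = θ * κ * (e n * c ^ (1 - a)) := by rw [ht]; ring
        _ ≤ _ := by gcongr
    refine this.trans (le_of_eq ?_)
    rw [hx]
    field_simp
  have hlow : μ + t ≤ paretoTruncMean c (a - δ) := by
    have h1 := paretoTruncMean_upper (y := a - δ) (x := a) hb1 hp (by linarith) (by linarith)
      haq.le hq
    have h2 : a - (a - δ) = δ := by ring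
    rw [h2, ← hC, show Real.log c = L n from rfl, ← hxeq] at h1
    have h3 : μ * Real.exp x ≤ paretoTruncMean c (a - δ) := by
      have := mul_le_mul_of_nonneg_right h1 (Real.exp_pos x).le
      rw [mul_assoc, ← Real.exp_add] at this
      simpa using this
    have h4 := Real.add_one_le_exp x
    have h5 : μ * (x + 1) ≤ μ * Real.exp x := by gcongr
    have h6 : 0 ≤ μ * (x ^ 2 / 2) := by positivity
    linarith
  have hupp : paretoTruncMean c (a + δ) ≤ μ - t := by
    have h1 := paretoTruncMean_upper (y := a) (x := a + δ) hb1 hp hpa.le (by linarith)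
      (by linarith) hq
    have h2 : a + δ - a = δ := by ring
    rw [h2, ← hC, show Real.log c = L n from rfl, ← hxeq] at h1
    have h5 : μ * Real.exp (-x) ≤ μ * (1 - x + x ^ 2 / 2) := by
      gcongr
      exact exp_neg_le_quadratic hx0.le
    linarith
  set V := a / (2 - a) * c ^ (2 - a) with hVdef
  have hca2 : 0 < c ^ (2 - a) := Real.rpow_pos_of_pos hb0 _
  have hV0 : 0 < V := by positivity
  have hV : ∫ y, trunc (b n) y ^ 2 ∂(paretoMeasure 1 a) ≤ V := by
    rw [integral_trunc_sq_paretoMeasure ha (by linarith) hb1.le]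
    have : 0 ≤ a / (2 - a) := by positivity
    simp only [hVdef]
    gcongr
    linarith
  obtain ⟨hu, hlo⟩ := truncMean_tail hY hindep ha hlaw (by omega) hb0 hV0 hV ht0
  rw [integral_trunc_paretoMeasure ha ha1 hb1.le] at hu hlo
  have hexp : Real.exp (-(n * (t ^ 2 / (2 * (V + b n * t / 3))))) ≤ 1 / (n : ℝ) ^ 2 := by
    refine exp_neg_le_inv_sq (by omega) ?_
    have e1 : c * c ^ (1 - a) = c ^ (2 - a) := by
      rw [mul_comm, ← Real.rpow_add_one hb0.ne']; congr 1; ring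
    have hU : V + c * t / 3 = c ^ (2 - a) * (a / (2 - a) + θ * κ * e n / 3) := by
      rw [hVdef, ht, ← e1]; ring
    have e2 : (c ^ (1 - a)) ^ 2 * c ^ a = c ^ (2 - a) := by
      rw [← Real.rpow_natCast, ← Real.rpow_mul hb0.le, ← Real.rpow_add hb0]
      congr 1; push_cast; ring
    have e3 : n * e n ^ 2 = D ^ 2 * (n : ℝ) ^ (1 - 2 * β) / L n := by
      simp only [he]
      rw [div_pow, mul_pow, Real.sq_sqrt hL0.le, Real.rpow_sub hn0, Real.rpow_one, mul_comm 2 β,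
        Real.rpow_mul hn0.le, Real.rpow_two]
      field_simp
    have hc' : c ^ a * Real.log n / (A * a) ≤ (n : ℝ) ^ (1 - 2 * β) / L n := by
      rw [le_div_iff₀ hln] at hc
      rw [div_le_div_iff₀ (by positivity) hL0]
      calc c ^ a * Real.log n * L n = c ^ a * Real.log c * Real.log n := by ring
        _ ≤ A * a * (n : ℝ) ^ (1 - 2 * β) := hc
        _ = _ := by ring
    rw [← mul_div_assoc, le_div_iff₀ (by positivity), hU]
    calc 2 * Real.log n * (2 * (c ^ (2 - a) * (a / (2 - a) + θ * κ * e n / 3)))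
        = c ^ (2 - a) * Real.log n * (4 * (a / (2 - a) + θ * κ * e n / 3)) := by ring
      _ ≤ c ^ (2 - a) * Real.log n * (σ * R) := by gcongr
      _ = θ ^ 2 * κ ^ 2 * (c ^ (1 - a)) ^ 2 * D ^ 2 * (c ^ a * Real.log n / (A * a)) := by
          rw [← e2, hθ2, hR]; ring
      _ ≤ θ ^ 2 * κ ^ 2 * (c ^ (1 - a)) ^ 2 * D ^ 2 * ((n : ℝ) ^ (1 - 2 * β) / L n) := by gcongr
      _ = θ ^ 2 * κ ^ 2 * (c ^ (1 - a)) ^ 2 * (n * e n ^ 2) := by rw [e3]; ring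
      _ = n * t ^ 2 := by rw [ht]; ring
  have := measureReal_le_of_subset_tails
    (S := {ω | D / ((n : ℝ) ^ β * Real.log c * √(Real.log c)) ≤
      |largestRoot l c (truncMean Y b n ω) - a|}) ?_ (hu.trans hexp) (hlo.trans hexp)
  · rwa [mul_one_div] at this
  · intro ω hω
    simp only [Set.mem_ofPred_eq, Set.mem_union] at hω ⊢
    rw [hδeq] at hω
    -- Outside both tails the sample mean lies strictly between the truncated means at `a + δ` and
    -- `a - δ`, which traps the root.
    by_contra! hcon
    obtain ⟨h1, h2, -⟩ := hroot (a - δ) (a + δ) (truncMean Y b n ω) (by linarith) (by linarith)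
      (by linarith) (hupp.trans_lt hcon.2) (hcon.1.trans_le hlow)
    have : |largestRoot l c (truncMean Y b n ω) - a| < δ := abs_lt.2 ⟨by linarith, by linarith⟩
    linarith

end Sample

/-! ### Linearization of the largest root -/

lemma abs_log_one_add_sub_le {u : ℝ} (hu : |u| ≤ 1 / 2) : |Real.log (1 + u) - u| ≤ 2 * u ^ 2 := by
  obtain ⟨h1, h2⟩ := abs_le.1 hu
  have hpos : 0 < 1 + u := by linarith
  have hup := Real.log_le_sub_one_of_pos hpos
  have hlo := Real.one_sub_inv_le_log_of_pos hpos
  have h3 : u - 2 * u ^ 2 ≤ 1 - (1 + u)⁻¹ := by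
    have h4 : 1 - (1 + u)⁻¹ = u / (1 + u) := by field_simp; ring
    rw [h4, le_div_iff₀ hpos]
    nlinarith [sq_nonneg u, mul_nonneg (sq_nonneg u) (by linarith : 0 ≤ 1 + 2 * u)]
  rw [abs_le]
  constructor
  · linarith
  · nlinarith [sq_nonneg u]

/-- The logarithm of the truncated mean is almost linear in the tail index, with slope `-log c`. -/
lemma abs_log_paretoTruncMean_sub_le {c x y p q : ℝ} (hc : 1 < c) (hp : 0 < p) (hq : q < 1)
    (hx : x ∈ Set.Icc p q) (hy : y ∈ Set.Icc p q) :
    |Real.log (paretoTruncMean c x) - Real.log (paretoTruncMean c y) + (x - y) * Real.log c| ≤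
      1 / (p * (1 - q)) * |x - y| := by
  wlog hyx : y ≤ x generalizing x y
  · have := this hy hx (le_of_not_ge hyx)
    rw [abs_sub_comm x y, ← abs_neg]
    convert! this using 2
    ring
  have hC : 0 < 1 / (p * (1 - q)) := by
    have : 0 < 1 - q := by linarith
    positivity
  have hx0 := paretoTruncMean_pos hc (by linarith [hx.1] : 0 < x) (by linarith [hx.2])
  have hy0 := paretoTruncMean_pos hc (by linarith [hy.1] : 0 < y) (by linarith [hy.2])
  have h1 := Real.log_le_log (by positivity)
    (paretoTruncMean_lower hc (by linarith [hy.1]) hyx (by linarith [hx.2]))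
  have h2 := Real.log_le_log hx0 (paretoTruncMean_upper hc hp hy.1 hyx hx.2 hq)
  rw [Real.log_mul hy0.ne' (Real.exp_pos _).ne', Real.log_exp] at h1 h2
  have hd : 0 ≤ x - y := sub_nonneg.2 hyx
  rw [abs_of_nonneg hd, abs_le]
  constructor
  · have := mul_nonneg hC.le hd
    linarith
  · linarith

/-- Here `u` is the relative error of the mean and `d` that of the root. Since `C < L / 2`, the term
`C * |d|` is absorbed to give `|d| * L ≤ 4 * |u|`; reinserting this bounds the slope error, and `log
(1 + u) - u` is quadratic. -/
lemma abs_mul_add_le_of_log {C L u d : ℝ} (hC : 0 < C) (hL : 2 * C < L) (hu : |u| ≤ 1 / 4)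
    (h : |Real.log (1 + u) + d * L| ≤ C * |d|) :
    |d * L + u| ≤ 2 * u ^ 2 + 4 * C * |u| / L := by
  have hL0 : 0 < L := by linarith
  have hsq : u ^ 2 = |u| * |u| := by rw [← sq, sq_abs]
  have hlu := abs_log_one_add_sub_le (u := u) (by linarith)
  have hlu2 : |Real.log (1 + u)| ≤ 2 * |u| := by
    have h1 : |Real.log (1 + u)| ≤ |Real.log (1 + u) - u| + |u| := by
      simpa using abs_add_le (Real.log (1 + u) - u) u
    have h2 : |u| * |u| ≤ 1 / 4 * |u| := mul_le_mul_of_nonneg_right hu (abs_nonneg _)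
    rw [hsq] at hlu
    have := abs_nonneg u
    linarith
  have hdL : |d| * L ≤ 4 * |u| := by
    have h1 : |d * L| ≤ |Real.log (1 + u) + d * L| + |Real.log (1 + u)| := by
      have := abs_sub (Real.log (1 + u) + d * L) (Real.log (1 + u))
      simpa using this
    rw [abs_mul, abs_of_pos hL0] at h1
    have h2 : C * |d| ≤ |d| * L / 2 := by
      have := mul_le_mul_of_nonneg_left hL.le (abs_nonneg d)
      linarith
    linarith
  have e1 : d * L + u = (Real.log (1 + u) + d * L) - (Real.log (1 + u) - u) := by ring
  have h1 : C * |d| ≤ 4 * C * |u| / L := by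
      rw [le_div_iff₀ hL0]
      have := mul_le_mul_of_nonneg_left hdL hC.le
      linarith
  rw [e1]
  refine (abs_sub _ _).trans ?_
  linarith

/-- Linearization of the largest root at the truncated mean. -/
lemma eventually_largestRoot_linearization {a l : ℝ} (hl : 0 ≤ l) (hla : l < a) (ha1 : a < 1)
    {b : ℕ → ℝ} (hb : Tendsto b atTop atTop)
    (hr : Tendsto (fun n : ℕ => b n ^ (a / 2) / √(n : ℝ)) atTop (𝓝 0)) {K ε : ℝ}
    (hε : 0 < ε) :
    ∀ᶠ n : ℕ in atTop, ∀ m : ℝ,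
      |√(n : ℝ) * (m - paretoTruncMean (b n) a) / b n ^ (1 - a / 2)| ≤ K →
      |√(n : ℝ) * (largestRoot l (b n) m - a) * Real.log (b n) / b n ^ (a / 2) +
        (1 - a) / a * (√(n : ℝ) * (m - paretoTruncMean (b n) a) / b n ^ (1 - a / 2))| < ε := by
  have ha : 0 < a := by linarith
  have ha1' := sub_pos.2 ha1
  obtain ⟨p, hlp, hpa⟩ := exists_between hla
  obtain ⟨q, haq, hq⟩ := exists_between ha1
  obtain ⟨z, haz, hzq⟩ := exists_between haq
  have hp : 0 < p := by linarith
  have hq1 := sub_pos.2 hq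
  set C := 1 / (p * (1 - q)) with hC
  have hC0 : 0 < C := by positivity
  set κ := (1 - a) / a with hκ
  have hκ0 : 0 < κ := by positivity
  -- The relative error of the mean factors as `u = w * r n * k n`, with `w` the standardized mean,
  -- `r n → 0` and `k n → κ`.
  set r : ℕ → ℝ := fun n => b n ^ (a / 2) / √(n : ℝ) with hrdef
  set L : ℕ → ℝ := fun n => Real.log (b n) with hLdef
  have hL : Tendsto L atTop atTop := Real.tendsto_log_atTop.comp hb
  set k : ℕ → ℝ := fun n => b n ^ (1 - a) / paretoTruncMean (b n) a with hkdef
  have hk : Tendsto k atTop (𝓝 κ) := by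
    have := (tendsto_paretoTruncMean_div hb ha1).inv₀ (by positivity)
    simpa [hκ, hkdef, inv_div] using this
  have hsmall : Tendsto (fun n => K * r n * k n) atTop (𝓝 0) := by
    simpa using (hr.const_mul K).mul hk
  have herr : Tendsto (fun n => 2 * K ^ 2 * k n ^ 2 * r n + 4 * C * K * k n / L n +
      |κ - k n| * K) atTop (𝓝 0) := by
    have h1 : Tendsto (fun n => 2 * K ^ 2 * k n ^ 2 * r n) atTop (𝓝 0) := by
      simpa using ((hk.pow 2).const_mul (2 * K ^ 2)).mul hr
    have h2 : Tendsto (fun n => 4 * C * K * k n / L n) atTop (𝓝 0) :=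
      (hk.const_mul (4 * C * K)).div_atTop hL
    have h3 : Tendsto (fun n => |κ - k n| * K) atTop (𝓝 0) := by
      simpa using ((hk.const_sub κ).abs).mul_const K
    simpa using (h1.add h2).add h3
  -- A fixed radius is enough to localize the root: `δ * (L n - C) > 1` makes the mean vary between
  -- `a - δ` and `a + δ` by more than `|u| < 1 / 4`. The logarithmic estimate then sharpens this.
  set δ := min (a - p) (z - a) with hδ
  have hδ0 : 0 < δ := lt_min (by linarith) (by linarith)
  have hδp : δ ≤ a - p := min_le_left _ _
  have hδz : δ ≤ z - a := min_le_right _ _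
  filter_upwards [hb.eventually_gt_atTop 1, eventually_gt_atTop 0,
    hL.eventually_gt_atTop (max (2 * C) (C + 1 / δ)), hk.eventually (lt_mem_nhds hκ0),
    hsmall.eventually (gt_mem_nhds (by norm_num : (0 : ℝ) < 1 / 4)),
    herr.eventually (gt_mem_nhds hε),
    hb.eventually (eventually_largestRoot_mem hl hlp (hpa.trans haz).le hzq hq)]
    with n hb1 hn hLn hkn hsm her hroot
  intro m hm
  have hn0 : (0 : ℝ) < n := by exact_mod_cast hn
  have hsn : 0 < √(n : ℝ) := Real.sqrt_pos.2 hn0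
  have hb0 : 0 < b n := by linarith
  obtain ⟨hL2, hLδ⟩ := max_lt_iff.1 hLn
  have hL0 : 0 < L n := by linarith
  set c := b n with hcdef
  set μ := paretoTruncMean c a with hμ
  have hμ0 : 0 < μ := paretoTruncMean_pos hb1 ha ha1
  have hrn : 0 < r n := by simp only [hrdef]; positivity
  set w := √(n : ℝ) * (m - μ) / c ^ (1 - a / 2) with hw
  set u := w * r n * k n with hu
  have hcp1 : 0 < c ^ (1 - a / 2) := Real.rpow_pos_of_pos hb0 _
  have humu : m = μ * (1 + u) := by
    have e1 : c ^ (a / 2) * c ^ (1 - a) = c ^ (1 - a / 2) := by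
      rw [← Real.rpow_add hb0]; congr 1; ring
    have e2 : u = (m - μ) / μ := by
      have : u = √(n : ℝ) * (m - μ) / c ^ (1 - a / 2) * (c ^ (a / 2) / √(n : ℝ)) *
        (c ^ (1 - a) / μ) := rfl
      rw [this]
      calc _ = (m - μ) / μ * ((c ^ (a / 2) * c ^ (1 - a)) / c ^ (1 - a / 2)) *
            (√(n : ℝ) / √(n : ℝ)) := by ring
        _ = _ := by rw [e1, div_self hcp1.ne', div_self hsn.ne', mul_one, mul_one]
    rw [e2]; field_simp; ring
  have huabs : |u| = |w| * r n * k n := by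
    rw [hu, abs_mul, abs_mul, abs_of_pos hrn, abs_of_pos hkn]
  have huK : |u| ≤ K * r n * k n := by rw [huabs]; gcongr
  have hu4 : |u| < 1 / 4 := huK.trans_lt hsm
  obtain ⟨hu1, hu2⟩ := abs_lt.1 hu4
  have hx1 : 1 < δ * (L n - C) := by
    have : 1 / δ < L n - C := by linarith
    rwa [div_lt_iff₀' hδ0] at this
  have hlow : m < paretoTruncMean c (a - δ) := by
    have h1 := paretoTruncMean_upper (y := a - δ) (x := a) hb1 hp (by linarith) (by linarith)
      haq.le hq
    have h2 : a - (a - δ) = δ := by ring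
    rw [h2, ← hC, show Real.log c = L n from rfl] at h1
    have h3 : μ * Real.exp (δ * (L n - C)) ≤ paretoTruncMean c (a - δ) := by
      have := mul_le_mul_of_nonneg_right h1 (Real.exp_pos (δ * (L n - C))).le
      rw [mul_assoc, ← Real.exp_add] at this
      simpa using this
    refine lt_of_lt_of_le ?_ h3
    rw [humu]
    have h4 := Real.add_one_le_exp (δ * (L n - C))
    exact mul_lt_mul_of_pos_left (by linarith) hμ0
  have hupp : paretoTruncMean c (a + δ) < m := by
    have h1 := paretoTruncMean_upper (y := a) (x := a + δ) hb1 hp hpa.le (by linarith)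
      (by linarith) hq
    have h2 : a + δ - a = δ := by ring
    rw [h2, ← hC, show Real.log c = L n from rfl] at h1
    refine h1.trans_lt ?_
    rw [humu]
    refine mul_lt_mul_of_pos_left ?_ hμ0
    have h3 : Real.exp (-(δ * (L n - C))) ≤ Real.exp (-1) := Real.exp_le_exp.2 (by linarith)
    have h4 := exp_neg_le_quadratic zero_le_one
    norm_num at h4
    linarith
  obtain ⟨hm1, hm2, hmm⟩ := hroot (a - δ) (a + δ) m (by linarith) (by linarith) (by linarith)
    hupp hlow
  set d := largestRoot l c m - a with hd
  have hlog := abs_log_paretoTruncMean_sub_le hb1 hp hq (x := largestRoot l c m) (y := a)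
    ⟨by linarith, by linarith⟩ ⟨hpa.le, haq.le⟩
  have hlm : Real.log m = Real.log μ + Real.log (1 + u) := by
    rw [humu, Real.log_mul hμ0.ne' (by linarith)]
  rw [hmm, ← hC, hlm, ← hd, show Real.log c = L n from rfl, add_sub_cancel_left] at hlog
  have hdu := abs_mul_add_le_of_log hC0 hL2 hu4.le hlog
  have hZ : √(n : ℝ) * d * Real.log c / c ^ (a / 2) = d * L n / r n := by
    have : 0 < c ^ (a / 2) := Real.rpow_pos_of_pos hb0 _
    simp only [hrdef]
    rw [show Real.log c = L n from rfl]
    change _ = d * L n / (c ^ (a / 2) / √(n : ℝ))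
    field_simp
  rw [hZ]
  have e2 : d * L n / r n + κ * w = (d * L n + u) / r n + (κ - k n) * w := by
    rw [hu]; field_simp; ring
  rw [e2]
  refine lt_of_le_of_lt ?_ her
  calc |(d * L n + u) / r n + (κ - k n) * w|
      ≤ |d * L n + u| / r n + |κ - k n| * |w| := by
        refine (abs_add_le _ _).trans (le_of_eq ?_)
        rw [abs_div, abs_mul, abs_of_pos hrn]
    _ ≤ (2 * u ^ 2 + 4 * C * |u| / L n) / r n + |κ - k n| * |w| := by gcongr
    _ = 2 * |w| ^ 2 * k n ^ 2 * r n + 4 * C * |w| * k n / L n + |κ - k n| * |w| := by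
        rw [← sq_abs u, huabs]; field_simp
    _ ≤ _ := by gcongr

/-! ### Asymptotic normality of the largest root -/

section Sample

variable {Ω : Type*} [MeasurableSpace Ω] {P : Measure Ω} [IsProbabilityMeasure P]
  {Y : ℕ → Ω → ℝ} {a : ℝ}

lemma tendsto_rpow_half_div_sqrt {b : ℕ → ℝ} (hb₀ : ∀ n, 0 < b n) (hb : Tendsto b atTop atTop)
    {A β : ℝ} (hβ : 0 ≤ β) (ha : 0 < a) (hA : 0 < A)
    (hcond : ∀ᶠ n : ℕ in atTop,
      b n ^ a * Real.log (b n) ≤ A * a * (n : ℝ) ^ (1 - 2 * β) / Real.log n) :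
    Tendsto (fun n : ℕ => b n ^ (a / 2) / √(n : ℝ)) atTop (𝓝 0) := by
  have hln : Tendsto (fun n : ℕ => Real.log n) atTop atTop :=
    Real.tendsto_log_atTop.comp tendsto_natCast_atTop_atTop
  have h1 : Tendsto (fun n : ℕ => b n ^ a / n) atTop (𝓝 0) := by
    have h2 : Tendsto (fun n : ℕ => A * a / Real.log n) atTop (𝓝 0) :=
      tendsto_const_nhds.div_atTop hln
    refine squeeze_zero' (Eventually.of_forall fun n => ?_) ?_ h2
    · have := Real.rpow_pos_of_pos (hb₀ n) a
      positivity
    · filter_upwards [hcond, eventually_gt_atTop 1,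
        (Real.tendsto_log_atTop.comp hb).eventually_ge_atTop 1] with n hc hn hL
      have hn1 : (1 : ℝ) < n := by exact_mod_cast hn
      have hn0 : (0 : ℝ) < n := by linarith
      have hlog := Real.log_pos hn1
      have hp := Real.rpow_pos_of_pos (hb₀ n) a
      rw [div_le_iff₀ hn0]
      calc b n ^ a ≤ b n ^ a * Real.log (b n) := le_mul_of_one_le_right hp.le hL
        _ ≤ A * a * (n : ℝ) ^ (1 - 2 * β) / Real.log n := hc
        _ ≤ A * a * (n : ℝ) ^ (1 : ℝ) / Real.log n := by
            gcongr
            · exact hn1.le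
            · linarith
        _ = _ := by rw [Real.rpow_one]; ring
  have := (Real.continuous_sqrt.tendsto 0).comp h1
  rw [Real.sqrt_zero] at this
  refine this.congr fun n => ?_
  simp only [Function.comp]
  rw [Real.sqrt_div (Real.rpow_pos_of_pos (hb₀ n) a).le, Real.sqrt_eq_rpow (b n ^ a),
    ← Real.rpow_mul (hb₀ n).le]
  congr 2; ring

/-- Asymptotic normality of the largest root. -/
lemma tendstoNormal_largestRoot (hY : ∀ k, Measurable (Y k)) (hindep : iIndepFun Y P)
    (hlaw : ∀ k, P.map (Y k) = paretoMeasure 1 a) {b : ℕ → ℝ} (hb₀ : ∀ n, 0 < b n)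
    (hb : Tendsto b atTop atTop) {l : ℝ} (hl : 0 ≤ l) (hla : l < a) (ha1 : a < 1)
    (hr : Tendsto (fun n : ℕ => b n ^ (a / 2) / √(n : ℝ)) atTop (𝓝 0)) :
    TendstoNormal P (fun n ω => √(n : ℝ) * (largestRoot l (b n) (truncMean Y b n ω) - a) *
      Real.log (b n) / b n ^ (a / 2)) ((1 - a) ^ 2 / (a * (2 - a))) := by
  have ha : 0 < a := by linarith
  have ha1' := sub_pos.2 ha1
  have ha2 : 0 < 2 - a := by linarith
  set v := a / (2 - a) with hv
  have hv0 : 0 < v := by positivity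
  have hspos : ∀ n, 0 < b n ^ (1 - a / 2) := fun n => Real.rpow_pos_of_pos (hb₀ n) _
  have hssq : ∀ n, (b n ^ (1 - a / 2)) ^ 2 = b n ^ (2 - a) := fun n => by
    rw [← Real.rpow_natCast, ← Real.rpow_mul (hb₀ n).le]
    congr 1; push_cast; ring
  have hbs : ∀ n, b n = b n ^ (a / 2) * b n ^ (1 - a / 2) := fun n => by
    rw [← Real.rpow_add (hb₀ n)]
    simp
  -- The scale squared, `b n ^ (2 - a)`, is the order of the second moment; the squared mean is
  -- smaller by a factor of order `b n ^ (-a)`, so it does not affect the variance.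
  have hclt := tendstoNormal_truncMean hY hindep ha hlaw hb₀ (s := fun n => b n ^ (1 - a / 2))
    (Eventually.of_forall hspos) ?_ (v := v) ?_ (-((1 - a) / a)) hv0.le
  · have hvar : (-((1 - a) / a)) ^ 2 * v = (1 - a) ^ 2 / (a * (2 - a)) := by
      rw [hv]; field_simp
    rw [hvar] at hclt
    refine tendstoInDistribution_of_tendstoInMeasure_sub _ _ hclt ?_ fun n => ?_
    · rw [tendstoInMeasure_iff_norm]
      intro ε hε
      rw [ENNReal.tendsto_nhds_zero]
      intro η hη
      -- Tightness from Bernstein: the standardized mean leaves `[-K, K]` with probability at most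
      -- this, for large `n`. So `K` is fixed first, and then the linearization is applied for that
      -- `K`.
      have hexp : Tendsto (fun K : ℝ => 2 * Real.exp (-(K ^ 2 / (2 * (v + 1))))) atTop (𝓝 0) := by
        have h1 : Tendsto (fun K : ℝ => K ^ 2 / (2 * (v + 1))) atTop atTop :=
          (tendsto_pow_atTop two_ne_zero).atTop_div_const (by positivity)
        simpa using (Real.tendsto_exp_neg_atTop_nhds_zero.comp h1).const_mul 2
      have hexp' := ENNReal.tendsto_ofReal hexp
      rw [ENNReal.ofReal_zero] at hexp'
      obtain ⟨K, hKη, hK⟩ :=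
        ((hexp'.eventually (ge_mem_nhds hη)).and (eventually_gt_atTop 0)).exists
      have hrK : Tendsto (fun n : ℕ => K * (b n ^ (a / 2) / √(n : ℝ)) / 3) atTop (𝓝 0) := by
        simpa using (hr.const_mul K).div_const 3
      filter_upwards [eventually_largestRoot_linearization (K := K) hl hla ha1 hb hr hε,
        hb.eventually_gt_atTop 1, eventually_gt_atTop 0,
        hrK.eventually (ge_mem_nhds one_pos)] with n hlin hb1 hn hr1
      have hn0 : (0 : ℝ) < n := by exact_mod_cast hn
      have hsn : 0 < √(n : ℝ) := Real.sqrt_pos.2 hn0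
      refine le_trans ?_ hKη
      rw [← ofReal_measureReal]
      refine ENNReal.ofReal_le_ofReal ?_
      set t := K * b n ^ (1 - a / 2) / √(n : ℝ) with ht
      have hs0 := hspos n
      have ht0 : 0 < t := by positivity
      have hca2 : 0 < b n ^ (2 - a) := Real.rpow_pos_of_pos (hb₀ n) _
      have hV : ∫ y, trunc (b n) y ^ 2 ∂(paretoMeasure 1 a) ≤ v * b n ^ (2 - a) := by
        rw [integral_trunc_sq_paretoMeasure ha (by linarith) hb1.le]
        gcongr
        linarith
      obtain ⟨hu, hlo⟩ := truncMean_tail hY hindep ha hlaw hn (hb₀ n)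
        (by positivity : 0 < v * b n ^ (2 - a)) hV ht0
      rw [integral_trunc_paretoMeasure ha ha1 hb1.le] at hu hlo
      have hE : Real.exp (-(n * (t ^ 2 / (2 * (v * b n ^ (2 - a) + b n * t / 3))))) ≤
          Real.exp (-(K ^ 2 / (2 * (v + 1)))) := by
        refine Real.exp_le_exp.2 (neg_le_neg ?_)
        have h1 : n * t ^ 2 = K ^ 2 * b n ^ (2 - a) := by
          rw [ht, div_pow, mul_pow, hssq, Real.sq_sqrt hn0.le]; field_simp
        have h2 : b n * t / 3 = b n ^ (2 - a) * (K * (b n ^ (a / 2) / √(n : ℝ)) / 3) := by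
          rw [ht, ← hssq]
          calc _ = (b n ^ (a / 2) * b n ^ (1 - a / 2)) * (K * b n ^ (1 - a / 2) / √(n : ℝ)) / 3 := by
                rw [← hbs]
            _ = _ := by ring
        rw [← mul_div_assoc, h1, h2, div_le_div_iff₀ (by positivity) (by
          have : 0 < b n ^ (a / 2) := Real.rpow_pos_of_pos (hb₀ n) _
          positivity)]
        calc K ^ 2 * (2 * (v * b n ^ (2 - a) +
              b n ^ (2 - a) * (K * (b n ^ (a / 2) / √(n : ℝ)) / 3)))
            ≤ K ^ 2 * (2 * (v * b n ^ (2 - a) + b n ^ (2 - a) * 1)) := by gcongr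
          _ = _ := by ring
      refine measureReal_le_of_subset_tails (fun ω hω => ?_) (hu.trans hE) (hlo.trans hE)
      simp only [Set.mem_ofPred_eq, Set.mem_union, Pi.sub_apply, Pi.zero_apply, sub_zero] at hω ⊢
      by_contra! hcon
      rw [integral_trunc_paretoMeasure ha ha1 hb1.le] at hω
      have hwK : |√(n : ℝ) * (truncMean Y b n ω - paretoTruncMean (b n) a) /
          b n ^ (1 - a / 2)| ≤ K := by
        have h1 : |truncMean Y b n ω - paretoTruncMean (b n) a| ≤ t :=
          abs_le.2 ⟨by linarith [hcon.2], by linarith [hcon.1]⟩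
        rw [abs_div, abs_mul, abs_of_pos hsn, abs_of_pos hs0, div_le_iff₀ hs0]
        calc _ ≤ √(n : ℝ) * t := by gcongr
          _ = _ := by rw [ht]; field_simp
      have h3 := hlin _ hwK
      rw [Real.norm_eq_abs, neg_mul, sub_neg_eq_add] at hω
      linarith
    · have := aemeasurable_largestRoot_truncMean hY ha hlaw hb₀ hl n
      fun_prop
  · refine hr.congr fun n => ?_
    have h1 := (hspos n).ne'
    calc b n ^ (a / 2) / √(n : ℝ)
        = b n ^ (a / 2) * b n ^ (1 - a / 2) / (√(n : ℝ) * b n ^ (1 - a / 2)) := by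
          rw [mul_div_mul_right _ _ h1]
      _ = _ := by rw [← hbs]
  · have h1 : Tendsto (fun n => v * (1 - b n ^ (-(2 - a))) -
        (paretoTruncMean (b n) a / b n ^ (1 - a)) ^ 2 * b n ^ (-a)) atTop (𝓝 v) := by
      simpa using (((tendsto_rpow_neg_comp hb ha2).const_sub 1).const_mul v).sub
        (((tendsto_paretoTruncMean_div hb ha1).pow 2).mul (tendsto_rpow_neg_comp hb ha))
    refine h1.congr' ?_
    filter_upwards [hb.eventually_gt_atTop 1] with n hb1
    rw [integral_trunc_sq_paretoMeasure ha (by linarith) hb1.le,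
      integral_trunc_paretoMeasure ha ha1 hb1.le, hssq, Real.rpow_neg (hb₀ n).le,
      Real.rpow_neg (hb₀ n).le]
    have e1 : b n ^ (2 - a) = (b n ^ (1 - a)) ^ 2 * b n ^ a := by
      rw [← Real.rpow_natCast, ← Real.rpow_mul (hb₀ n).le, ← Real.rpow_add (hb₀ n)]
      congr 1; push_cast; ring
    have e2 : 0 < b n ^ (1 - a) := Real.rpow_pos_of_pos (hb₀ n) _
    have e3 : 0 < b n ^ a := Real.rpow_pos_of_pos (hb₀ n) _
    rw [e1, ← hv]
    field_simp

end Sample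

/-! ### Reduction of indices above one by squaring -/

section Squares

variable {Ω : Type*} [MeasurableSpace Ω] {P : Measure Ω} {X : ℕ → Ω → ℝ} {α : ℝ}

lemma trunc_sq {c x : ℝ} (hc : 0 < c) (hx : 0 < x) : trunc c x ^ 2 = trunc (c ^ 2) (x ^ 2) := by
  unfold trunc
  by_cases h : x ≤ c
  · rw [if_pos h, if_pos (pow_le_pow_left₀ hx.le h 2)]
  · rw [if_neg h, if_neg (fun h2 => h ((pow_le_pow_iff_left₀ hx.le hc.le two_ne_zero).1 h2))]
    norm_num

lemma ae_truncSecond_eq (hX : ∀ k, Measurable (X k)) (hα : 0 < α)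
    (hlaw : ∀ k, P.map (X k) = paretoMeasure 1 α) {b : ℕ → ℝ} (hb₀ : ∀ n, 0 < b n) (n : ℕ) :
    ∀ᵐ ω ∂P, truncSecond X b n ω =
      truncMean (fun k ω => X k ω ^ 2) (fun n => b n ^ 2) n ω := by
  filter_upwards [ae_all_iff.2 fun k => ae_one_lt_of_map_eq (hX k) hα (hlaw k)] with ω h
  unfold truncSecond truncMean
  congr 1
  exact Finset.sum_congr rfl fun k _ => trunc_sq (hb₀ n) (by linarith [h k])

lemma map_sq_eq_paretoMeasure [IsProbabilityMeasure P] {X : Ω → ℝ} (hX : Measurable X)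
    (hα : 0 < α) (hdist : ∀ x : ℝ, 1 ≤ x → P.real {ω | X ω ≤ x} = 1 - 1 / x ^ α) :
    P.map (fun ω => X ω ^ 2) = paretoMeasure 1 (α / 2) := by
  have hlaw := map_eq_paretoMeasure hX hα hdist
  refine map_eq_paretoMeasure (hX.pow_const 2) (by linarith) fun x hx => ?_
  have h1 : 1 ≤ √x := Real.one_le_sqrt.2 hx
  have h2 : P.real {ω | X ω ^ 2 ≤ x} = P.real {ω | X ω ≤ √x} := by
    refine measureReal_congr ?_
    filter_upwards [ae_one_lt_of_map_eq hX hα hlaw] with ω hω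
    refine propext ?_
    change X ω ^ 2 ≤ x ↔ X ω ≤ √x
    rw [Real.le_sqrt' (by linarith)]
  rw [h2, hdist _ h1, Real.sqrt_eq_rpow, ← Real.rpow_mul (by linarith)]
  congr 3; ring

/-- Replacing `c` by `c ^ 2` doubles the logarithm in the denominator, and `(2 - 2 * x) / (2 * x) =
(1 - x) / x`. -/
lemma G₂_two_mul (c v x : ℝ) : G₂ c v (2 * x) = 2 * G₁ (c ^ 2) v x := by
  unfold G₁ G₂
  have e : (2 - 2 * x) / (2 * x) = (1 - x) / x := by
    rw [← mul_div_mul_left (1 - x) x two_ne_zero]; congr 1; ring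
  rw [e, Real.log_pow]
  push_cast
  rw [div_mul_eq_div_div, div_right_comm]
  ring

-- Doubling maps the roots in `(1 / 2, 1)` onto those in `(1, 2)`, and commutes with `sSup` even
-- when there are none, as both sides are then `0`.
omit [MeasurableSpace Ω] in
lemma alphaHat'_eq_two_mul_largestRoot {b : ℕ → ℝ} (n : ℕ) (ω : Ω) :
    alphaHat' X b n ω = 2 * largestRoot (1 / 2) (b n ^ 2) (truncSecond X b n ω) := by
  unfold alphaHat' largestRoot
  rw [← smul_eq_mul, ← Real.sSup_smul_of_nonneg zero_le_two]
  congr 1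
  ext y
  rw [Set.mem_smul_set]
  constructor
  · rintro ⟨h1, h2, h3⟩
    refine ⟨y / 2, ⟨by linarith, by linarith, ?_⟩, by simp [mul_div_cancel₀]⟩
    have := G₂_two_mul (b n) (truncSecond X b n ω) (y / 2)
    rw [mul_div_cancel₀ y two_ne_zero, ← h3] at this
    linarith
  · rintro ⟨x, ⟨h1, h2, h3⟩, rfl⟩
    have := G₂_two_mul (b n) (truncSecond X b n ω) x
    simp only [smul_eq_mul]
    refine ⟨by linarith, by linarith, ?_⟩
    rw [this, ← h3]

end Squares

lemma tendsto_div_of_le_rpow_div_log {b : ℕ → ℝ} (hb₀ : ∀ n, 0 < b n) {γ : ℝ} (hγ : γ ≤ 1)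
    (hcond : ∀ᶠ n : ℕ in atTop, b n ≤ (n : ℝ) ^ γ / Real.log n) :
    Tendsto (fun n : ℕ => b n / n) atTop (𝓝 0) := by
  have hln : Tendsto (fun n : ℕ => 1 / Real.log n) atTop (𝓝 0) :=
    tendsto_const_nhds.div_atTop (Real.tendsto_log_atTop.comp tendsto_natCast_atTop_atTop)
  refine squeeze_zero' (Eventually.of_forall fun n => ?_) ?_ hln
  · have := hb₀ n
    positivity
  · filter_upwards [hcond, eventually_gt_atTop 1] with n hc hn
    have hn1 : (1 : ℝ) < n := by exact_mod_cast hn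
    have hn0 : (0 : ℝ) < n := by linarith
    have hlog := Real.log_pos hn1
    rw [div_le_iff₀ hn0]
    calc b n ≤ (n : ℝ) ^ γ / Real.log n := hc
      _ ≤ (n : ℝ) ^ (1 : ℝ) / Real.log n := by
          gcongr
          exact hn1.le
      _ = _ := by rw [Real.rpow_one]; ring

end TailIndex

end

/-! ### The four cases -/

theorem theorem3 {Ω : Type*} [MeasurableSpace Ω] (P : Measure Ω) [IsProbabilityMeasure P]
    (X : ℕ → Ω → ℝ) (hX : ∀ k, Measurable (X k)) (hindep : iIndepFun X P)
    (α : ℝ) (hα₀ : 0 < α) (hα₂ : α ≤ 2)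
    (hdist : ∀ k, ∀ x : ℝ, 1 ≤ x → P.real {ω | X k ω ≤ x} = 1 - 1 / x ^ α)
    (b : ℕ → ℝ) (hb_pos : ∀ n, 0 < b n) (hb_mono : Monotone b) (hb : Tendsto b atTop atTop)
    (β : ℝ) (hβ₀ : 0 ≤ β) (hβ₁ : β < 1 / 2) :
    -- the case `0 < α < 1`
    (α < 1 →
      (∀ᶠ n : ℕ in atTop,
        b n ^ α * Real.log (b n) ≤ α * (n : ℝ) ^ (1 - 2 * β) / Real.log n) →
      (∀ᶠ n : ℕ in atTop,
        P.real {ω | 2 / ((n : ℝ) ^ β * Real.log (b n) * √(Real.log (b n)))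
            ≤ |TailIndex.alphaHat X b n ω - α|} ≤ 2 / (n : ℝ) ^ 2) ∧
      TailIndex.TendstoNormal P
        (fun n ω => √(n : ℝ) * (TailIndex.alphaHat X b n ω - α) * Real.log (b n)
          / b n ^ (α / 2))
        ((1 - α) ^ 2 / (α * (2 - α)))) ∧
    -- the case `1 < α < 2`
    (1 < α → α < 2 →
      (∀ᶠ n : ℕ in atTop,
        b n ^ α * Real.log (b n) ≤ α * (n : ℝ) ^ (1 - 2 * β) / Real.log n) →
      (∀ᶠ n : ℕ in atTop,
        P.real {ω | 2 / ((n : ℝ) ^ β * Real.log (b n) * √(Real.log (b n)))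
            ≤ |TailIndex.alphaHat' X b n ω - α|} ≤ 2 / (n : ℝ) ^ 2) ∧
      TailIndex.TendstoNormal P
        (fun n ω => √(n : ℝ) * (TailIndex.alphaHat' X b n ω - α) * Real.log (b n)
          / b n ^ (α / 2))
        ((2 - α) ^ 2 / (α * (4 - α)))) ∧
    -- the case `α = 1`
    (α = 1 →
      (∀ᶠ n : ℕ in atTop, b n ≤ (n : ℝ) ^ (1 - 2 * β) / Real.log n) →
      (∀ᶠ n : ℕ in atTop,
        P.real {ω | 2 * √2 / ((n : ℝ) ^ β * Real.log (b n))
            ≤ |TailIndex.alphaHatOne X b n ω - 1|} ≤ 2 / (n : ℝ) ^ 2) ∧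
      TailIndex.TendstoNormal P
        (fun n ω => √(n : ℝ) * (TailIndex.alphaHatOne X b n ω - 1) * Real.log (b n)
          / √(b n))
        1) ∧
    -- the case `α = 2`
    (α = 2 →
      ((∀ᶠ n : ℕ in atTop, b n ^ 2 ≤ (n : ℝ) ^ (1 - 2 * β) / Real.log n) →
        ∀ᶠ n : ℕ in atTop,
          P.real {ω | 2 * √2 / ((n : ℝ) ^ β * Real.log (b n))
              ≤ |TailIndex.alphaHatTwo X b n ω - 2|} ≤ 2 / (n : ℝ) ^ 2) ∧
      ((∀ᶠ n : ℕ in atTop, b n ^ 2 ≤ (n : ℝ) ^ (1 - β) / Real.log n) →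
        TailIndex.TendstoNormal P
          (fun n ω => √(n : ℝ) * (TailIndex.alphaHatTwo X b n ω - 2) * Real.log (b n)
            / b n)
          1)) := by
  have hlaw : ∀ k, P.map (X k) = paretoMeasure 1 α := fun k =>
    TailIndex.map_eq_paretoMeasure (hX k) hα₀ (hdist k)
  have hXsq : ∀ k, Measurable fun ω => X k ω ^ 2 := fun k => (hX k).pow_const 2
  have hindep_sq : iIndepFun (fun k ω => X k ω ^ 2) P :=
    hindep.comp (fun _ x => x ^ 2) fun _ => measurable_id.pow_const 2
  have hlaw_sq : ∀ k, P.map (fun ω => X k ω ^ 2) = paretoMeasure 1 (α / 2) := fun k =>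
    TailIndex.map_sq_eq_paretoMeasure (hX k) hα₀ (hdist k)
  have hb_sq : Tendsto (fun n => b n ^ 2) atTop atTop :=
    (tendsto_pow_atTop two_ne_zero).comp hb
  have hb_sq_pos : ∀ n, 0 < b n ^ 2 := fun n => pow_pos (hb_pos n) 2
  have hsecond := TailIndex.ae_truncSecond_eq hX hα₀ hlaw hb_pos
  have hlog_sq : ∀ n, Real.log (b n ^ 2) = 2 * Real.log (b n) := fun n => by
    rw [Real.log_pow]; norm_num
  refine ⟨fun hα₁ hcond => ⟨?_, ?_⟩, fun hα₁ hα₂' hcond => ?_, fun hα₁ hcond => ?_,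
    fun hα₂' => ⟨fun hcond => ?_, fun hcond => ?_⟩⟩
  · exact TailIndex.largestRoot_concentration hX hindep hα₁ hlaw hb hβ₀ le_rfl hα₀ one_pos
      two_pos (by nlinarith) (by simpa using hcond)
  · exact TailIndex.tendstoNormal_largestRoot hX hindep hlaw hb_pos hb le_rfl hα₀ hα₁
      (TailIndex.tendsto_rpow_half_div_sqrt hb_pos hb hβ₀ hα₀ one_pos (by simpa using hcond))
  · have hrpow : ∀ n, ∀ y : ℝ, (b n ^ 2) ^ (y / 2) = b n ^ y := fun n y => by
      rw [← Real.rpow_natCast, ← Real.rpow_mul (hb_pos n).le]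
      congr 1; push_cast; ring
    -- The constant is `4` because `log (b n ^ 2)` doubles the left side and `α = 2 * (α / 2)`.
    have hcond' : ∀ᶠ n : ℕ in atTop, (b n ^ 2) ^ (α / 2) * Real.log (b n ^ 2) ≤
        4 * (α / 2) * (n : ℝ) ^ (1 - 2 * β) / Real.log n := by
      filter_upwards [hcond] with n hn
      rw [hrpow, hlog_sq]
      calc b n ^ α * (2 * Real.log (b n)) = 2 * (b n ^ α * Real.log (b n)) := by ring
        _ ≤ 2 * (α * (n : ℝ) ^ (1 - 2 * β) / Real.log n) := by gcongr
        _ = _ := by ring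
    have hroot : ∀ n, ∀ᵐ ω ∂P, TailIndex.alphaHat' X b n ω = 2 * TailIndex.largestRoot (1 / 2)
        (b n ^ 2) (TailIndex.truncMean (fun k ω => X k ω ^ 2) (fun n => b n ^ 2) n ω) := by
      intro n
      filter_upwards [hsecond n] with ω hω
      rw [TailIndex.alphaHat'_eq_two_mul_largestRoot, hω]
    have h2 : √2 ^ 2 = (2 : ℝ) := Real.sq_sqrt (by norm_num)
    constructor
    · have h := TailIndex.largestRoot_concentration hXsq hindep_sq (by linarith : α / 2 < 1)
        hlaw_sq hb_sq hβ₀ (l := 1 / 2) (by norm_num) (by linarith) (A := 4) (D := 2 * √2)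
        (by norm_num) (by positivity) (by rw [mul_pow, h2]; nlinarith) hcond'
      filter_upwards [h, hb.eventually_gt_atTop 1, eventually_gt_atTop 0] with n hn hb1 hn0
      refine le_trans (le_of_eq (measureReal_congr ?_)) hn
      filter_upwards [hroot n] with ω hω
      refine propext ?_
      change _ ≤ |TailIndex.alphaHat' X b n ω - α| ↔ _ ≤ |_|
      have hL := Real.log_pos hb1
      have hsL := Real.sqrt_pos.2 hL
      have hnβ : 0 < (n : ℝ) ^ β := Real.rpow_pos_of_pos (by exact_mod_cast hn0) _
      have e1 : 2 * √2 / ((n : ℝ) ^ β * Real.log (b n ^ 2) * √(Real.log (b n ^ 2))) =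
          2 / ((n : ℝ) ^ β * Real.log (b n) * √(Real.log (b n))) / 2 := by
        rw [hlog_sq, Real.sqrt_mul zero_le_two]
        field_simp
      rw [hω, e1]
      generalize TailIndex.largestRoot _ _ _ = ρ
      have e2 : |2 * ρ - α| = |ρ - α / 2| * 2 := by
        rw [← abs_of_pos (two_pos : (0 : ℝ) < 2), ← abs_mul]
        simp only [abs_two]
        congr 1; ring
      rw [e2]
      exact (div_le_iff₀ two_pos).symm
    · have h := TailIndex.tendstoNormal_largestRoot hXsq hindep_sq hlaw_sq hb_sq_pos hb_sq
        (l := 1 / 2) (by norm_num) (by linarith) (by linarith : α / 2 < 1)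
        (TailIndex.tendsto_rpow_half_div_sqrt hb_sq_pos hb_sq hβ₀ (by linarith) four_pos hcond')
      have hv : (1 - α / 2) ^ 2 / (α / 2 * (2 - α / 2)) = (2 - α) ^ 2 / (α * (4 - α)) := by
        have : 4 - α ≠ 0 := by linarith
        rw [show 2 - α / 2 = (4 - α) / 2 by ring, show 1 - α / 2 = (2 - α) / 2 by ring]
        field_simp
      rw [hv] at h
      -- The factor `2` from doubling the root is the one in `log (b n ^ 2)`, so the limit variance
      -- is not rescaled.
      refine h.congr (fun n => ?_) (ae_eq_refl _)
      filter_upwards [hroot n] with ω hω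
      rw [hω, hlog_sq, hrpow]
      ring
  · subst hα₁
    exact ⟨TailIndex.truncMean_div_log_concentration hX hindep hlaw hb hβ₀ hcond,
      TailIndex.tendstoNormal_truncMean_div_log hX hindep hlaw hb_pos hb
        (TailIndex.tendsto_div_of_le_rpow_div_log hb_pos (by linarith) hcond)⟩
  · subst hα₂'
    norm_num at hlaw_sq
    have h := TailIndex.truncMean_div_log_concentration hXsq hindep_sq hlaw_sq hb_sq hβ₀ hcond
    filter_upwards [h, hb.eventually_gt_atTop 1] with n hn hb1
    refine le_trans (le_of_eq (measureReal_congr ?_)) hn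
    filter_upwards [hsecond n] with ω hω
    refine propext ?_
    change _ ≤ |TailIndex.truncSecond X b n ω / Real.log (b n) - 2| ↔ _ ≤ |_|
    have hL := Real.log_pos hb1
    rw [hω, hlog_sq]
    generalize TailIndex.truncMean _ _ _ _ = m
    have e1 : 2 * √2 / ((n : ℝ) ^ β * (2 * Real.log (b n))) =
        2 * √2 / ((n : ℝ) ^ β * Real.log (b n)) / 2 := by
      rw [div_div]; congr 1; ring
    have e2 : |m / Real.log (b n) - 2| = |m / (2 * Real.log (b n)) - 1| * 2 := by
      rw [← abs_of_pos (two_pos : (0 : ℝ) < 2), ← abs_mul]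
      simp only [abs_two]
      congr 1; field_simp
    rw [e1, e2]
    exact (div_le_iff₀ two_pos).symm
  · subst hα₂'
    norm_num at hlaw_sq
    have h := TailIndex.tendstoNormal_truncMean_div_log hXsq hindep_sq hlaw_sq hb_sq_pos hb_sq
        (TailIndex.tendsto_div_of_le_rpow_div_log hb_sq_pos (by linarith) hcond)
    refine h.congr (fun n => ?_) (ae_eq_refl _)
    filter_upwards [hsecond n] with ω hω
    rw [TailIndex.alphaHatTwo, hω, hlog_sq, Real.sqrt_sq (hb_pos n).le]
    congr 1
    -- The two sequences are compared for every `n`, including levels with `b n = 1`, where division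
    -- by zero must be checked.
    by_cases hL : Real.log (b n) = 0
    · simp [hL]
    · field_simp
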